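/- Let $\mathfrak K=\mathbb C^2$, let $\mathfrak H=\mathfrak K\otimes L^2(0,\infty)$, identified with the square integrable $\mathfrak K$-valued functions on $(0,\infty)$, let $(S_tf)(x)=f(x-t)$ for $x>t$ and $(S_tf)(x)=0$ for $x\le t$ be the right shift, $E(t,\infty)=S_tS_t^*$, and let $\Lambda:\mathfrak B(\mathfrak K)\to\mathfrak B(\mathfrak H)$, $(\Lambda(A)f)(x)=e^{-x}Af(x)$. Put $\mathfrak A(\mathfrak H)=(I-\Lambda(I))^{1/2}\,\mathfrak B(\mathfrak H)\,(I-\Lambda(I))^{1/2}$, and let $\mathfrak A(\mathfrak H)_*$ be the space of linear functionals $\mu$ on $\mathfrak A(\mathfrak H)$ for which $A\mapsto\mu\big((I-\Lambda(I))^{1/2}A(I-\Lambda(I))^{1/2}\big)$ is a normal bounded functional on $\mathfrak B(\mathfrak H)$. A *$q$-weight map over $\mathfrak K$* is a completely positive linear map $\omega:\mathfrak B(\mathfrak K)_*\to\mathfrak A(\mathfrak H)_*$ with $\omega(\rho)(I-\Lambda(I))\le\rho(I)$ for all positive $\rho$ such that for every $t>0$, with $\omega|_t(\rho)(A)=\omega(\rho)\big(E(t,\infty)AE(t,\infty)\big)$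 and $\hat\Lambda\eta=\eta\circ\Lambda$, the map $I+\hat\Lambda\,\omega|_t$ is invertible and $\hat\pi_t=\omega|_t(I+\hat\Lambda\,\omega|_t)^{-1}:\mathfrak B(\mathfrak K)_*\to\mathfrak B(\mathfrak H)_*$ is a completely positive contraction. The dual maps $\pi_t^\#:\mathfrak B(\mathfrak H)\to\mathfrak B(\mathfrak K)$ of the $\hat\pi_t$ form its *generalized boundary representation*. Its *normal spine* is the normal completely positive contraction $\pi_0^\#:\mathfrak B(\mathfrak H)\to\mathfrak B(\mathfrak K)$ with $\pi_t^\#(A)\to\pi_0^\#(A)$ $\sigma$-strongly as $t\to0+$ for all $A\in\bigcup_{s>0}S_s\mathfrak B(\mathfrak H)S_s^*$; it is *trivial* if $\pi_0^\#=0$. The *range rank* of $\omega$ is the dimension of the range of the map $\breve\omega:\mathfrak A(\mathfrak H)\to\mathfrak B(\mathfrak K)$ determined by $\rho(\breve\omega(B))=\omega(\rho)(B)$. The map $\omega$ is *unital* if $\omega(\rho)(I-\Lambda(I))=\rho(I)$ for all $\rho\in\mathfrak B(\mathfrak K)_*$. A $q$-weight map $\eta$ with generalized boundary representation $\xi_t^\#$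 is a *$q$-subordinate* of $\omega$ if $\pi_t^\#-\xi_t^\#$ is completely positive for every $t>0$, and $\omega$ is *$q$-pure* if its set of $q$-subordinates is totally ordered by $q$-subordination. **Theorem.** Let $\omega$ be a $q$-weight map over $\mathbb C^2$ with trivial normal spine. If $\omega\ne0$, then $\omega$ has range rank $1$, $2$ or $4$. If $\omega$ is unital and $q$-pure, then it has range rank $1$ or $4$. -/

import Mathlib

open MeasureTheory Set Filter Topology
open scoped ENNReal NNReal InnerProductSpace ComplexOrder

set_option linter.unusedSectionVars false

noncomputable section

namespace QWeight

/-! ### Normal functionals -/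

section Normal

variable {H : Type*} [NormedAddCommGroup H] [InnerProductSpace ℂ H]

/-- The vector functional `A ↦ (f, A g)` on `𝔅(H)` (conjugate linear in `f`). -/
def vecFunctional (f g : H) : StrongDual ℂ (H →L[ℂ] H) :=
  (innerSL ℂ f) ∘L (ContinuousLinearMap.apply ℂ H g)

theorem vecFunctional_apply (f g : H) (A : H →L[ℂ] H) : vecFunctional f g A = ⟪f, A g⟫_ℂ := rfl

variable (H) in
/-- The predual `𝔅(H)_*`: the normal (that is, `σ`-weakly continuous) functionals on `𝔅(H)`,
which form the norm-closed linear span of the vector functionals in the dual of `𝔅(H)`. -/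
def predual : Submodule ℂ (StrongDual ℂ (H →L[ℂ] H)) :=
  (Submodule.span ℂ (range fun p : H × H => vecFunctional p.1 p.2)).topologicalClosure

variable (H) in
/-- The pairing of `𝔅(H)_*` with `𝔅(H)`. -/
def predualPairing : predual H →ₗ[ℂ] Module.Dual ℂ (H →L[ℂ] H) :=
  ContinuousLinearMap.coeLM ℂ ∘ₗ (predual H).subtype

theorem vecFunctional_mem (f g : H) : vecFunctional f g ∈ predual H :=
  Submodule.le_topologicalClosure _ (Submodule.subset_span ⟨(f, g), rfl⟩)

/-- If `ℓ` is normal, so is `A ↦ ℓ (C A D)`. -/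
theorem predual_mulLeftRight [CompleteSpace H] {ℓ : StrongDual ℂ (H →L[ℂ] H)} (hℓ : ℓ ∈ predual H)
    (C D : H →L[ℂ] H) :
    ℓ ∘L (ContinuousLinearMap.mulLeftRight ℂ (H →L[ℂ] H) C D) ∈ predual H := by
  let T : StrongDual ℂ (H →L[ℂ] H) →L[ℂ] StrongDual ℂ (H →L[ℂ] H) :=
    (ContinuousLinearMap.compL ℂ (H →L[ℂ] H) (H →L[ℂ] H) ℂ).flip
      (ContinuousLinearMap.mulLeftRight ℂ (H →L[ℂ] H) C D)
  have hT : Submodule.span ℂ (range fun p : H × H => vecFunctional p.1 p.2) ≤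
      (predual H).comap (T : StrongDual ℂ (H →L[ℂ] H) →ₗ[ℂ] StrongDual ℂ (H →L[ℂ] H)) := by
    rw [Submodule.span_le]
    rintro _ ⟨⟨f, g⟩, rfl⟩
    have : T (vecFunctional f g) = vecFunctional (ContinuousLinearMap.adjoint C f) (D g) := by
      ext A
      simp [T, vecFunctional_apply, ContinuousLinearMap.adjoint_inner_left]
    simp only [Submodule.comap_coe, mem_preimage, SetLike.mem_coe]
    exact this ▸ vecFunctional_mem _ _
  have hcl : IsClosed ((predual H).comap
      (T : StrongDual ℂ (H →L[ℂ] H) →ₗ[ℂ] StrongDual ℂ (H →L[ℂ] H)) :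
      Set (StrongDual ℂ (H →L[ℂ] H))) :=
    (Submodule.isClosed_topologicalClosure (Submodule.span ℂ
      (range fun p : H × H => vecFunctional p.1 p.2))).preimage T.continuous
  exact Submodule.topologicalClosure_minimal _ hT hcl hℓ

end Normal

/-! ### The predual in finite dimension, and dual maps -/

section Dual

variable (K : Type*) [NormedAddCommGroup K] [InnerProductSpace ℂ K] [FiniteDimensional ℂ K]

theorem evalPredual_bijective :
    Function.Bijective (predualPairing K).flip := by
  have hinj : Function.Injective (predualPairing K).flip := by
    rw [← LinearMap.ker_eq_bot, LinearMap.ker_eq_bot']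
    intro B hB
    ext g
    refine ext_inner_left ℂ fun f => ?_
    have := LinearMap.congr_fun hB ⟨vecFunctional f g, vecFunctional_mem f g⟩
    simpa [predualPairing, vecFunctional_apply] using this
  refine ⟨hinj, ?_⟩
  have h1 : Module.finrank ℂ (Module.Dual ℂ (predual K)) ≤ Module.finrank ℂ (K →L[ℂ] K) := by
    refine (Subspace.dual_finrank_eq (K := ℂ) (V := predual K)).trans_le ?_
    refine (Submodule.finrank_le (predual K)).trans ?_
    rw [← LinearEquiv.finrank_eq (LinearMap.toContinuousLinearMap (𝕜 := ℂ)
      (E := K →L[ℂ] K) (F' := ℂ))]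
    exact (Subspace.dual_finrank_eq (K := ℂ) (V := K →L[ℂ] K)).le
  have h2 := LinearMap.finrank_le_finrank_of_injective hinj
  exact (LinearMap.injective_iff_surjective_of_finrank_eq_finrank (le_antisymm h2 h1)).1 hinj

/-- For finite-dimensional `K`, the identification of `𝔅(K)` with the dual of `𝔅(K)_*`. -/
def evalPredual : (K →L[ℂ] K) ≃ₗ[ℂ] Module.Dual ℂ (predual K) :=
  LinearEquiv.ofBijective (predualPairing K).flip (evalPredual_bijective K)

/-- For finite-dimensional `K`, every functional on `𝔅(K)` is normal. -/
theorem predual_eq_top : predual K = ⊤ := by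
  refine Submodule.eq_top_of_finrank_eq ?_
  rw [← Subspace.dual_finrank_eq (K := ℂ) (V := predual K), ← (evalPredual K).finrank_eq,
    ← LinearEquiv.finrank_eq (LinearMap.toContinuousLinearMap (𝕜 := ℂ)
      (E := K →L[ℂ] K) (F' := ℂ))]
  exact (Subspace.dual_finrank_eq (K := ℂ) (V := K →L[ℂ] K)).symm

variable {K}

/-- The dual map `Φ : V → 𝔅(K)` of a map `Ψ` from `𝔅(K)_*` to the functionals on `V`;
it is determined by `ρ (Φ v) = Ψ ρ v`. -/
def dualMap {V : Type*} [AddCommGroup V] [Module ℂ V] (Ψ : predual K →ₗ[ℂ] Module.Dual ℂ V) :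
    V →ₗ[ℂ] (K →L[ℂ] K) :=
  (evalPredual K).symm.toLinearMap ∘ₗ Ψ.flip

theorem dualMap_spec {V : Type*} [AddCommGroup V] [Module ℂ V]
    (Ψ : predual K →ₗ[ℂ] Module.Dual ℂ V) (ρ : predual K) (v : V) :
    ρ.1 (dualMap Ψ v) = Ψ ρ v := by
  have h : evalPredual K (dualMap Ψ v) = Ψ.flip v := by simp [dualMap]
  exact LinearMap.congr_fun h ρ

end Dual

/-! ### Complete positivity -/

section CP

variable {H K : Type*} [NormedAddCommGroup H] [InnerProductSpace ℂ H] [CompleteSpace H]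
  [NormedAddCommGroup K] [InnerProductSpace ℂ K] [CompleteSpace K]

/-- Complete positivity of a linear map from `𝔅(H)` to `𝔅(K)`. -/
def IsCP (Φ : (H →L[ℂ] H) →ₗ[ℂ] (K →L[ℂ] K)) : Prop :=
  ∃ Ψ : CompletelyPositiveMap (H →L[ℂ] H) (K →L[ℂ] K), Ψ.toLinearMap = Φ

/-- Complete positivity of a linear map from a space `V ⊆ 𝔅(H)` of operators to `𝔅(K)`: every
matrix over `V` that is positive as a matrix over `𝔅(H)` is mapped to a positive matrix. -/
def IsCPOn (V : Submodule ℂ (H →L[ℂ] H)) (Φ : V →ₗ[ℂ] (K →L[ℂ] K)) : Prop :=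
  ∀ (n : ℕ) (T : CStarMatrix (Fin n) (Fin n) V),
    0 ≤ T.map (fun A : V => (A : H →L[ℂ] H)) → 0 ≤ T.map Φ

/-- `σ`-strong convergence of a family of bounded operators. -/
def TendstoSigmaStrong {ι : Type*} (F : ι → (K →L[ℂ] K)) (l : Filter ι) (T : K →L[ℂ] K) : Prop :=
  ∀ v : ℕ → K, Summable (fun n => ‖v n‖ ^ 2) →
    Tendsto (fun i => ∑' n, ‖(F i - T) (v n)‖ ^ 2) l (𝓝 0)

end CP

/-! ### The Hilbert space `K ⊗ L²(0,∞)`, multiplication operators and shifts -/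

/-- Lebesgue measure on `(0,∞)`. -/
abbrev halfLine : Measure ℝ := volume.restrict (Ioi (0 : ℝ))

/-- `K ⊗ L²(0,∞)`, as the space of square integrable `K`-valued functions on `(0,∞)`. -/
def HalfL2 (K : Type*) [NormedAddCommGroup K] : Type _ := Lp K 2 halfLine

namespace HalfL2

variable {K : Type*} [NormedAddCommGroup K]

instance : NormedAddCommGroup (HalfL2 K) := inferInstanceAs (NormedAddCommGroup (Lp K 2 halfLine))

instance [InnerProductSpace ℂ K] : InnerProductSpace ℂ (HalfL2 K) :=
  inferInstanceAs (InnerProductSpace ℂ (Lp K 2 halfLine))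

instance [CompleteSpace K] : CompleteSpace (HalfL2 K) :=
  inferInstanceAs (CompleteSpace (Lp K 2 halfLine))

/-- A representative of an element of `K ⊗ L²(0,∞)`. -/
def toFun (f : HalfL2 K) : ℝ → K := ((show Lp K 2 halfLine from f) : ℝ → K)

instance : CoeFun (HalfL2 K) fun _ => ℝ → K := ⟨toFun⟩

/-- The class of a square integrable function. -/
def mk (f : ℝ → K) (hf : MemLp f 2 halfLine) : HalfL2 K := hf.toLp f

theorem coeFn_mk (f : ℝ → K) (hf : MemLp f 2 halfLine) : mk f hf =ᵐ[halfLine] f := hf.coeFn_toLp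

theorem memLp (f : HalfL2 K) : MemLp f 2 halfLine := Lp.memLp (show Lp K 2 halfLine from f)

theorem ext {f g : HalfL2 K} (h : f =ᵐ[halfLine] g) : f = g := Lp.ext h

theorem coeFn_add (f g : HalfL2 K) : (f + g).toFun =ᵐ[halfLine] fun x => f x + g x :=
  Lp.coeFn_add (show Lp K 2 halfLine from f) g

theorem coeFn_sub (f g : HalfL2 K) : (f - g).toFun =ᵐ[halfLine] fun x => f x - g x :=
  Lp.coeFn_sub (show Lp K 2 halfLine from f) g

theorem coeFn_smul [InnerProductSpace ℂ K] (c : ℂ) (f : HalfL2 K) :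
    (c • f).toFun =ᵐ[halfLine] fun x => c • f x :=
  Lp.coeFn_smul c (show Lp K 2 halfLine from f)

theorem norm_def (f : HalfL2 K) : ‖f‖ = (eLpNorm f 2 halfLine).toReal :=
  Lp.norm_def (show Lp K 2 halfLine from f)

theorem norm_mk (f : ℝ → K) (hf : MemLp f 2 halfLine) : ‖mk f hf‖ = (eLpNorm f 2 halfLine).toReal :=
  Lp.norm_toLp f hf

theorem inner_def [InnerProductSpace ℂ K] (f g : HalfL2 K) :
    ⟪f, g⟫_ℂ = ∫ x, ⟪f x, g x⟫_ℂ ∂halfLine :=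
  L2.inner_def (𝕜 := ℂ) (show Lp K 2 halfLine from f) g

end HalfL2

theorem measurePreserving_sub (t : ℝ≥0) :
    MeasurePreserving (fun x : ℝ => x - t) (volume.restrict (Ioi (t : ℝ))) halfLine := by
  have h := (measurePreserving_sub_right (volume : Measure ℝ) (t : ℝ)).restrict_preimage
    (measurableSet_Ioi (a := (0 : ℝ)))
  simpa using h

theorem halfLine_restrict (t : ℝ≥0) :
    halfLine.restrict (Ioi (t : ℝ)) = volume.restrict (Ioi (t : ℝ)) := by
  rw [Measure.restrict_restrict measurableSet_Ioi, Ioi_inter_Ioi]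
  simp

theorem shift_memLp {K : Type*} [NormedAddCommGroup K] (t : ℝ≥0) (f : HalfL2 K) :
    MemLp ((Ioi (t : ℝ)).indicator fun x => f (x - t)) 2 halfLine := by
  rw [memLp_indicator_iff_restrict measurableSet_Ioi, halfLine_restrict]
  exact f.memLp.comp_measurePreserving (measurePreserving_sub t)

theorem ae_shift (t : ℝ≥0) {p : ℝ → Prop} (hp : ∀ᵐ x ∂halfLine, p x) :
    ∀ᵐ x ∂halfLine, x ∈ Ioi (t : ℝ) → p (x - t) := by
  rw [← ae_restrict_iff' measurableSet_Ioi, halfLine_restrict]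
  exact (measurePreserving_sub t).quasiMeasurePreserving.ae hp

section Ops

variable {K : Type*} [NormedAddCommGroup K] [InnerProductSpace ℂ K]

/-- Multiplication by an essentially bounded function on `K ⊗ L²(0,∞)`. -/
def mulOp (φ : ℝ → ℂ) (hφ : MemLp φ ∞ halfLine) : HalfL2 K →L[ℂ] HalfL2 K :=
  ((ContinuousLinearMap.lsmul ℂ ℂ).holderL halfLine ∞ 2 2 (hφ.toLp φ) :
    Lp K 2 halfLine →L[ℂ] Lp K 2 halfLine)

theorem mulOp_apply (φ : ℝ → ℂ) (hφ : MemLp φ ∞ halfLine) (f : HalfL2 K) :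
    mulOp φ hφ f =ᵐ[halfLine] fun x => φ x • f x := by
  have h1 := (ContinuousLinearMap.lsmul ℂ ℂ (E := K)).coeFn_holder (r := 2) (hφ.toLp φ)
    (show Lp K 2 halfLine from f)
  filter_upwards [h1, hφ.coeFn_toLp] with x h1 h2
  refine Eq.trans h1 ?_
  rw [h2]
  rfl

theorem memLp_exp : MemLp (fun x : ℝ => ((Real.exp (-x) : ℝ) : ℂ)) ∞ halfLine := by
  refine memLp_top_of_bound (by fun_prop) 1 ?_
  filter_upwards [ae_restrict_mem measurableSet_Ioi] with x hx
  rw [Complex.norm_real, Real.norm_of_nonneg (Real.exp_pos _).le]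
  exact Real.exp_le_one_iff.2 (by simpa using (mem_Ioi.1 hx).le)

/-- Pointwise application of an operator on `K` to elements of `K ⊗ L²(0,∞)`. -/
def ampl (A : K →L[ℂ] K) : HalfL2 K →L[ℂ] HalfL2 K :=
  (A.compLpL 2 halfLine : Lp K 2 halfLine →L[ℂ] Lp K 2 halfLine)

theorem ampl_apply (A : K →L[ℂ] K) (f : HalfL2 K) :
    ampl A f =ᵐ[halfLine] fun x => A (f x) :=
  A.coeFn_compLpL (show Lp K 2 halfLine from f)

/-- `Λ(A) f (x) = e^{-x} A f(x)`. -/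
def Lam : (K →L[ℂ] K) →ₗ[ℂ] (HalfL2 K →L[ℂ] HalfL2 K) where
  toFun A := mulOp (fun x => ((Real.exp (-x) : ℝ) : ℂ)) memLp_exp ∘L ampl A
  map_add' A B := by
    rw [← ContinuousLinearMap.comp_add]
    exact congrArg _ (ContinuousLinearMap.add_compLpL A B)
  map_smul' c A := by
    rw [RingHom.id_apply, ← ContinuousLinearMap.comp_smul]
    exact congrArg _ (ContinuousLinearMap.smul_compLpL c A)

theorem Lam_apply (A : K →L[ℂ] K) (f : HalfL2 K) :
    Lam A f =ᵐ[halfLine] fun x => ((Real.exp (-x) : ℝ) : ℂ) • A (f x) := by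
  filter_upwards [mulOp_apply (K := K) _ memLp_exp (ampl A f), ampl_apply A f] with x h1 h2
  rw [← h2]
  exact h1

/-- The right shift: `(S_t f)(x) = f (x - t)` for `x > t`, and `0` for `x ≤ t`. -/
def shiftFun (t : ℝ≥0) (f : HalfL2 K) : HalfL2 K :=
  HalfL2.mk ((Ioi (t : ℝ)).indicator fun x => f (x - t)) (shift_memLp t f)

theorem shiftFun_apply (t : ℝ≥0) (f : HalfL2 K) :
    shiftFun t f =ᵐ[halfLine] (Ioi (t : ℝ)).indicator fun x => f (x - t) :=
  HalfL2.coeFn_mk _ _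

theorem norm_shiftFun (t : ℝ≥0) (f : HalfL2 K) : ‖shiftFun t f‖ = ‖f‖ := by
  rw [shiftFun, HalfL2.norm_mk, HalfL2.norm_def,
    eLpNorm_indicator_eq_eLpNorm_restrict measurableSet_Ioi, halfLine_restrict]
  exact congrArg ENNReal.toReal (eLpNorm_comp_measurePreserving
    f.memLp.aestronglyMeasurable (measurePreserving_sub t))

/-- The right shift `S_t` as an isometry. -/
def shift (t : ℝ≥0) : HalfL2 K →L[ℂ] HalfL2 K :=
  LinearMap.mkContinuous
    { toFun := shiftFun t
      map_add' := fun f g => by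
        refine HalfL2.ext ?_
        filter_upwards [ae_shift t (HalfL2.coeFn_add f g), shiftFun_apply t (f + g),
          shiftFun_apply t f, shiftFun_apply t g,
          HalfL2.coeFn_add (shiftFun t f) (shiftFun t g)] with x hx h1 h2 h3 h4
        rw [h1, h4, h2, h3]
        by_cases h : x ∈ Ioi (t : ℝ)
        · simpa only [indicator_of_mem h] using hx h
        · simp only [indicator_of_notMem h, add_zero]
      map_smul' := fun c f => by
        refine HalfL2.ext ?_
        filter_upwards [ae_shift t (HalfL2.coeFn_smul c f), shiftFun_apply t (c • f),
          shiftFun_apply t f, HalfL2.coeFn_smul c (shiftFun t f)] with x hx h1 h2 h4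
        rw [RingHom.id_apply, h1, h4, h2]
        by_cases h : x ∈ Ioi (t : ℝ)
        · simpa only [indicator_of_mem h] using hx h
        · simp only [indicator_of_notMem h, smul_zero] } 1
    (fun f => by rw [one_mul]; exact (norm_shiftFun t f).le)

theorem shift_apply (t : ℝ≥0) (f : HalfL2 K) :
    shift t f =ᵐ[halfLine] (Ioi (t : ℝ)).indicator fun x => f (x - t) :=
  shiftFun_apply t f

theorem norm_shift (t : ℝ≥0) (f : HalfL2 K) : ‖shift t f‖ = ‖f‖ := norm_shiftFun t f

theorem mulOp_mul (φ ψ χ : ℝ → ℂ) (hφ : MemLp φ ∞ halfLine) (hψ : MemLp ψ ∞ halfLine)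
    (hχ : MemLp χ ∞ halfLine) (h : ∀ x ∈ Ioi (0 : ℝ), φ x * ψ x = χ x) :
    mulOp (K := K) φ hφ * mulOp ψ hψ = mulOp χ hχ := by
  ext1 f
  refine HalfL2.ext ?_
  filter_upwards [mulOp_apply φ hφ (mulOp ψ hψ f), mulOp_apply ψ hψ f, mulOp_apply χ hχ f,
    ae_restrict_mem measurableSet_Ioi] with x h1 h2 h3 hx
  rw [h3, ← h x hx, mul_smul, ← h2]
  exact h1

theorem mulOp_isSelfAdjoint [CompleteSpace K] (φ : ℝ → ℝ)
    (hφ : MemLp (fun x => (φ x : ℂ)) ∞ halfLine) :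
    IsSelfAdjoint (mulOp (K := K) (fun x => (φ x : ℂ)) hφ) := by
  rw [ContinuousLinearMap.isSelfAdjoint_iff_isSymmetric]
  intro f g
  simp only [ContinuousLinearMap.coe_coe, HalfL2.inner_def]
  refine integral_congr_ae ?_
  filter_upwards [mulOp_apply _ hφ f, mulOp_apply _ hφ g] with x h1 h2
  rw [h1, h2, inner_smul_left, inner_smul_right, Complex.conj_ofReal]

theorem mulOp_nonneg [CompleteSpace K] (φ ψ : ℝ → ℝ) (hφ : MemLp (fun x => (φ x : ℂ)) ∞ halfLine)
    (hψ : MemLp (fun x => (ψ x : ℂ)) ∞ halfLine) (h : ∀ x ∈ Ioi (0 : ℝ), ψ x * ψ x = φ x) :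
    0 ≤ mulOp (K := K) (fun x => (φ x : ℂ)) hφ := by
  rw [← mulOp_mul _ _ _ hψ hψ hφ (fun x hx => by exact_mod_cast h x hx)]
  exact (mulOp_isSelfAdjoint ψ hψ).mul_self_nonneg

variable [CompleteSpace K]

/-- `E(t,∞) = S_t S_t^*`. -/
def E (t : ℝ≥0) : HalfL2 K →L[ℂ] HalfL2 K :=
  shift t * ContinuousLinearMap.adjoint (shift (K := K) t)

theorem memLp_indicator (t : ℝ≥0) (g : ℝ → ℝ) (hg : Measurable g) (C : ℝ)
    (hC : ∀ x ∈ Ioi (t : ℝ), ‖g x‖ ≤ C) :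
    MemLp (fun x : ℝ => (((Ioi (t : ℝ)).indicator g x : ℝ) : ℂ)) ∞ halfLine := by
  refine memLp_top_of_bound
    (Complex.measurable_ofReal.comp (hg.indicator measurableSet_Ioi)).aestronglyMeasurable
    (max C 0) (Eventually.of_forall fun x => ?_)
  rw [Complex.norm_real]
  by_cases h : x ∈ Ioi (t : ℝ)
  · rw [indicator_of_mem h]; exact (hC x h).trans (le_max_left _ _)
  · simp [indicator_of_notMem h]

/-- `E(t,∞)` is multiplication by the indicator function of `(t,∞)`. -/
theorem E_eq (t : ℝ≥0) : E (K := K) t =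
    mulOp (fun x => (((Ioi (t : ℝ)).indicator (fun _ => (1 : ℝ)) x : ℝ) : ℂ))
      (memLp_indicator t _ measurable_const 1 (by simp)) := by
  set M : HalfL2 K →L[ℂ] HalfL2 K :=
    mulOp (fun x => (((Ioi (t : ℝ)).indicator (fun _ => (1 : ℝ)) x : ℝ) : ℂ))
      (memLp_indicator t _ measurable_const 1 (by simp)) with hM
  have hMad : ContinuousLinearMap.adjoint M = M := (mulOp_isSelfAdjoint _ _).adjoint_eq
  have hiso : ContinuousLinearMap.adjoint (shift (K := K) t) ∘L shift t = 1 :=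
    (ContinuousLinearMap.norm_map_iff_adjoint_comp_self _).1 (norm_shift t)
  have hMS : M ∘L shift t = shift t := by
    ext1 f
    refine HalfL2.ext ?_
    filter_upwards [mulOp_apply _ (memLp_indicator t (g := fun _ => 1) measurable_const 1 (by simp)) (shift t f),
      shift_apply t f] with x h1 h2
    refine Eq.trans h1 ?_
    rw [h2]
    by_cases h : x ∈ Ioi (t : ℝ)
    · simp [indicator_of_mem h]
    · simp [indicator_of_notMem h]
  have hSM : ContinuousLinearMap.adjoint (shift (K := K) t) ∘L M
      = ContinuousLinearMap.adjoint (shift t) := by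
    rw [← hMad, ← ContinuousLinearMap.adjoint_comp, hMS]
  have hex : ∀ f : HalfL2 K, ∃ g : HalfL2 K, shift t g = M f := by
    intro f
    have hadd : MeasurePreserving (fun x : ℝ => x + t) halfLine
        (volume.restrict (Ioi (t : ℝ))) := by
      have h := (measurePreserving_add_right (volume : Measure ℝ) (t : ℝ)).restrict_preimage
        (measurableSet_Ioi (a := (t : ℝ)))
      simpa using h
    have hf : MemLp f 2 (volume.restrict (Ioi (t : ℝ))) :=
      halfLine_restrict t ▸ f.memLp.restrict _
    have hg := hf.comp_measurePreserving hadd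
    refine ⟨HalfL2.mk _ hg, HalfL2.ext ?_⟩
    filter_upwards [mulOp_apply _ (memLp_indicator t (g := fun _ => 1) measurable_const 1 (by simp)) f,
      shift_apply t (HalfL2.mk _ hg), ae_shift t (HalfL2.coeFn_mk _ hg)] with x h1 h2 h3
    refine h2.trans (Eq.trans ?_ h1.symm)
    by_cases h : x ∈ Ioi (t : ℝ)
    · rw [indicator_of_mem h, h3 h]
      simp [indicator_of_mem h]
    · simp [indicator_of_notMem h]
  ext1 f
  obtain ⟨g, hg⟩ := hex f
  calc E t f = shift t ((ContinuousLinearMap.adjoint (shift t) ∘L M) f) := by rw [hSM]; rfl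
    _ = shift t ((ContinuousLinearMap.adjoint (shift t) ∘L shift t) g) := by
        simp only [ContinuousLinearMap.comp_apply, hg]
    _ = M f := by rw [hiso, ← hg]; rfl

variable (K) in
/-- `(I - Λ(I))^{1/2}`. -/
def R : HalfL2 K →L[ℂ] HalfL2 K := CFC.sqrt (1 - Lam 1)

theorem one_sub_exp_mem {x : ℝ} (hx : x ∈ Ioi (0 : ℝ)) :
    0 ≤ 1 - Real.exp (-x) ∧ 1 - Real.exp (-x) ≤ 1 :=
  ⟨sub_nonneg.2 (Real.exp_le_one_iff.2 (by simpa using (mem_Ioi.1 hx).le)),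
    sub_le_self _ (Real.exp_pos _).le⟩

theorem memLp_of_le_one (g : ℝ → ℝ) (hg : Measurable g)
    (h : ∀ x ∈ Ioi (0 : ℝ), ‖g x‖ ≤ 1) : MemLp (fun x => (g x : ℂ)) ∞ halfLine := by
  refine memLp_top_of_bound (Complex.measurable_ofReal.comp hg).aestronglyMeasurable 1 ?_
  filter_upwards [ae_restrict_mem measurableSet_Ioi] with x hx
  rw [Complex.norm_real]
  exact h x hx

theorem memLp_sqrt : MemLp (fun x : ℝ => ((√(1 - Real.exp (-x)) : ℝ) : ℂ)) ∞ halfLine :=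
  memLp_of_le_one _ (by fun_prop) fun x hx => by
    rw [Real.norm_of_nonneg (Real.sqrt_nonneg _)]
    exact Real.sqrt_le_one.2 (one_sub_exp_mem hx).2

theorem memLp_sqrt_sqrt : MemLp (fun x : ℝ => ((√√(1 - Real.exp (-x)) : ℝ) : ℂ)) ∞ halfLine :=
  memLp_of_le_one _ (by fun_prop) fun x hx => by
    rw [Real.norm_of_nonneg (Real.sqrt_nonneg _)]
    exact Real.sqrt_le_one.2 (Real.sqrt_le_one.2 (one_sub_exp_mem hx).2)

theorem mulOp_sqrt_mul_self :
    mulOp (K := K) _ memLp_sqrt * mulOp _ memLp_sqrt = 1 - Lam 1 := by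
  ext1 f
  refine HalfL2.ext ?_
  filter_upwards [mulOp_apply _ memLp_sqrt (mulOp _ memLp_sqrt f), mulOp_apply _ memLp_sqrt f,
    Lam_apply 1 f, HalfL2.coeFn_sub f (Lam 1 f), ae_restrict_mem measurableSet_Ioi] with
    x h1 h2 h3 h4 hx
  refine Eq.trans h1 (Eq.trans ?_ h4.symm)
  rw [h2, h3, smul_smul, ← Complex.ofReal_mul,
    Real.mul_self_sqrt (one_sub_exp_mem hx).1]
  simp [sub_smul]

/-- `(I - Λ(I))^{1/2}` is multiplication by `(1 - e^{-x})^{1/2}`. -/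
theorem R_eq : R K = mulOp _ memLp_sqrt :=
  CFC.sqrt_unique mulOp_sqrt_mul_self
    (mulOp_nonneg _ _ memLp_sqrt memLp_sqrt_sqrt
      (fun _ _ => Real.mul_self_sqrt (Real.sqrt_nonneg _)))

theorem R_mul_R : R K * R K = 1 - Lam 1 := by rw [R_eq, mulOp_sqrt_mul_self]

/-- `E(t,∞)` factors through `(I - Λ(I))^{1/2}` on either side. -/
theorem exists_E_factor {t : ℝ≥0} (ht : 0 < t) :
    ∃ G : HalfL2 K →L[ℂ] HalfL2 K, R K * G = E t ∧ G * R K = E t := by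
  have ht' : (0 : ℝ) < t := ht
  have hpos : ∀ x ∈ Ioi (t : ℝ), 0 < √(1 - Real.exp (-x)) := fun x hx =>
    Real.sqrt_pos.2 (sub_pos.2 (Real.exp_lt_one_iff.2 (by have := mem_Ioi.1 hx; linarith)))
  have hG := memLp_indicator t (fun x => (√(1 - Real.exp (-x)))⁻¹) (by fun_prop)
    (√(1 - Real.exp (-(t : ℝ))))⁻¹ (fun x hx => by
      rw [Real.norm_of_nonneg (inv_nonneg.2 (Real.sqrt_nonneg _))]
      refine inv_anti₀ (Real.sqrt_pos.2 (sub_pos.2 (Real.exp_lt_one_iff.2 (by linarith)))) ?_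
      refine Real.sqrt_le_sqrt (sub_le_sub_left (Real.exp_le_exp.2 ?_) _)
      exact neg_le_neg (mem_Ioi.1 hx).le)
  refine ⟨mulOp _ hG, ?_, ?_⟩ <;> rw [R_eq, E_eq] <;> refine mulOp_mul _ _ _ _ _ _ fun x _ => ?_
  all_goals
    by_cases h : x ∈ Ioi (t : ℝ)
    · simp only [indicator_of_mem h]
      rw [← Complex.ofReal_mul]
      congr 1
      have := (hpos x h).ne'
      field_simp
    · simp [indicator_of_notMem h]

end Ops

/-! ### Boundary weights and boundary weight maps -/

section Weights

variable (K : Type*) [NormedAddCommGroup K] [InnerProductSpace ℂ K] [CompleteSpace K]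

/-- The map `A ↦ (I - Λ(I))^{1/2} A (I - Λ(I))^{1/2}` on `𝔅(K ⊗ L²(0,∞))`. -/
def conjR : (HalfL2 K →L[ℂ] HalfL2 K) →L[ℂ] (HalfL2 K →L[ℂ] HalfL2 K) :=
  ContinuousLinearMap.mulLeftRight ℂ _ (R K) (R K)

/-- The boundary algebra `𝔄 = (I - Λ(I))^{1/2} 𝔅 (I - Λ(I))^{1/2}`. -/
def boundaryAlgebra : Submodule ℂ (HalfL2 K →L[ℂ] HalfL2 K) :=
  LinearMap.range (conjR K).toLinearMap

variable {K}

theorem conjR_mem (A : HalfL2 K →L[ℂ] HalfL2 K) : conjR K A ∈ boundaryAlgebra K := ⟨A, rfl⟩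

variable (K) in
theorem one_sub_Lam_mem : 1 - Lam 1 ∈ boundaryAlgebra K :=
  ⟨1, by rw [← R_mul_R]; simp [conjR]⟩

theorem E_mul_mul_E_mem {t : ℝ≥0} (ht : 0 < t) (A : HalfL2 K →L[ℂ] HalfL2 K) :
    E t * A * E t ∈ boundaryAlgebra K := by
  obtain ⟨G, h1, h2⟩ := exists_E_factor (K := K) ht
  refine ⟨G * A * G, ?_⟩
  change R K * (G * A * G) * R K = _
  calc R K * (G * A * G) * R K = (R K * G) * A * (G * R K) := by noncomm_ring
    _ = _ := by rw [h1, h2]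

variable (K) in
/-- The boundary weights `𝔄_*`: the linear functionals `μ` on `𝔄` for which
`A ↦ μ ((I - Λ(I))^{1/2} A (I - Λ(I))^{1/2})` is a bounded normal functional. -/
def boundaryWeights : Submodule ℂ (Module.Dual ℂ (boundaryAlgebra K)) where
  carrier := {μ | ∃ ℓ ∈ predual (HalfL2 K), ∀ A, ℓ A = μ ⟨conjR K A, conjR_mem A⟩}
  add_mem' := by
    rintro μ ν ⟨ℓ, hℓ, h⟩ ⟨m, hm, h'⟩
    exact ⟨ℓ + m, add_mem hℓ hm, fun A => by simp [h, h']⟩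
  zero_mem' := ⟨0, zero_mem _, fun A => by simp⟩
  smul_mem' := by
    rintro c μ ⟨ℓ, hℓ, h⟩
    exact ⟨c • ℓ, Submodule.smul_mem _ c hℓ, fun A => by simp [h]⟩

/-- The functional `A ↦ μ (E(t,∞) A E(t,∞))` on `𝔅`, for `t > 0`. -/
def truncFun {t : ℝ≥0} (ht : 0 < t) :
    Module.Dual ℂ (boundaryAlgebra K) →ₗ[ℂ] Module.Dual ℂ (HalfL2 K →L[ℂ] HalfL2 K) :=
  Module.Dual.transpose (R := ℂ)
    ((ContinuousLinearMap.mulLeftRight ℂ _ (E (K := K) t) (E t)).toLinearMap.codRestrict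
      (boundaryAlgebra K) (E_mul_mul_E_mem ht))

theorem truncFun_apply {t : ℝ≥0} (ht : 0 < t) (μ : Module.Dual ℂ (boundaryAlgebra K))
    (A : HalfL2 K →L[ℂ] HalfL2 K) :
    truncFun ht μ A = μ ⟨E t * A * E t, E_mul_mul_E_mem ht A⟩ := rfl

theorem truncFun_normal {t : ℝ≥0} (ht : 0 < t) {μ : Module.Dual ℂ (boundaryAlgebra K)}
    (hμ : μ ∈ boundaryWeights K) :
    ∃ ℓ ∈ predual (HalfL2 K), ∀ A, ℓ A = truncFun ht μ A := by
  obtain ⟨ℓ, hℓ, h⟩ := hμ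
  obtain ⟨G, h1, h2⟩ := exists_E_factor (K := K) ht
  refine ⟨_, predual_mulLeftRight hℓ G G, fun A => ?_⟩
  rw [truncFun_apply]
  refine (h (G * A * G)).trans (congrArg μ (Subtype.ext ?_))
  change R K * (G * A * G) * R K = _
  calc R K * (G * A * G) * R K = (R K * G) * A * (G * R K) := by noncomm_ring
    _ = _ := by rw [h1, h2]

/-- The truncation `μ|_t (A) = μ (E(t,∞) A E(t,∞))` of a boundary weight, for `t > 0`. -/
def trunc {t : ℝ≥0} (ht : 0 < t) : boundaryWeights K →ₗ[ℂ] predual (HalfL2 K) where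
  toFun μ := ⟨⟨truncFun ht μ.1, by
    obtain ⟨ℓ, _, h⟩ := truncFun_normal ht μ.2
    exact ℓ.continuous.congr h⟩, by
    obtain ⟨ℓ, hℓ, h⟩ := truncFun_normal ht μ.2
    convert! hℓ
    ext A
    exact (h A).symm⟩
  map_add' _ _ := rfl
  map_smul' _ _ := rfl

theorem trunc_apply {t : ℝ≥0} (ht : 0 < t) (μ : boundaryWeights K)
    (A : HalfL2 K →L[ℂ] HalfL2 K) :
    (trunc ht μ).1 A = μ.1 ⟨E t * A * E t, E_mul_mul_E_mem ht A⟩ := rfl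

variable (K) in
/-- A boundary weight map over `K`: a linear map from `𝔅(K)_*` to `𝔄_*`. -/
abbrev BoundaryWeightMap : Type _ := predual K →ₗ[ℂ] boundaryWeights K

/-! ### `q`-weight maps over a finite-dimensional space -/

variable [FiniteDimensional ℂ K]

variable (K) in
/-- The predual map `η ↦ η ∘ Λ` of `Λ`. -/
def LamHat : predual (HalfL2 K) →ₗ[ℂ] predual K where
  toFun η := ⟨η.1 ∘L LinearMap.toContinuousLinearMap Lam, by rw [predual_eq_top]; trivial⟩
  map_add' _ _ := rfl
  map_smul' _ _ := rfl

namespace BoundaryWeightMap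

variable (ω : BoundaryWeightMap K)

/-- The dualized boundary weight map `𝔄 → 𝔅(K)`. -/
def dualized : boundaryAlgebra K →ₗ[ℂ] (K →L[ℂ] K) :=
  dualMap ((boundaryWeights K).subtype ∘ₗ ω)

theorem dualized_spec (ρ : predual K) (B : boundaryAlgebra K) :
    ρ.1 (ω.dualized B) = (ω ρ).1 B :=
  dualMap_spec _ ρ B

/-- The range rank: the dimension of the range of the dualized map. -/
def rangeRank : ℕ := Module.finrank ℂ (LinearMap.range ω.dualized)

/-- The map `I + Λ̂ ω|_t` on `𝔅(K)_*`. -/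
def oneAdd {t : ℝ≥0} (ht : 0 < t) : Module.End ℂ (predual K) :=
  1 + LamHat K ∘ₗ trunc ht ∘ₗ ω

/-- The map `π̂_t = ω|_t (I + Λ̂ ω|_t)⁻¹` (used only when `I + Λ̂ ω|_t` is invertible). -/
def piHat {t : ℝ≥0} (ht : 0 < t) : predual K →ₗ[ℂ] predual (HalfL2 K) :=
  trunc ht ∘ₗ ω ∘ₗ Ring.inverse (ω.oneAdd ht)

/-- The generalized boundary representation: the dual map `π_t^# : 𝔅(K ⊗ L²) → 𝔅(K)`
of `π̂_t`. -/
def bdryRep {t : ℝ≥0} (ht : 0 < t) : (HalfL2 K →L[ℂ] HalfL2 K) →ₗ[ℂ] (K →L[ℂ] K) :=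
  dualMap (predualPairing (HalfL2 K) ∘ₗ ω.piHat ht)

theorem bdryRep_spec {t : ℝ≥0} (ht : 0 < t) (ρ : predual K) (A : HalfL2 K →L[ℂ] HalfL2 K) :
    ρ.1 (ω.bdryRep ht A) = (ω.piHat ht ρ).1 A :=
  dualMap_spec _ ρ A

/-- `q`-weight maps over `K`. (A map of preduals is completely positive when its dual map is.) -/
structure IsQWeightMap : Prop where
  cp : IsCPOn (boundaryAlgebra K) ω.dualized
  bound : ∀ ρ : predual K, (∀ A : K →L[ℂ] K, 0 ≤ A → 0 ≤ ρ.1 A) →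
    (ω ρ).1 ⟨1 - Lam 1, one_sub_Lam_mem K⟩ ≤ ρ.1 1
  invertible : ∀ (t : ℝ≥0) (ht : 0 < t), IsUnit (ω.oneAdd ht)
  piHat_cp : ∀ (t : ℝ≥0) (ht : 0 < t), IsCP (ω.bdryRep ht)
  piHat_contraction : ∀ (t : ℝ≥0) (ht : 0 < t) (ρ : predual K), ‖ω.piHat ht ρ‖ ≤ ‖ρ‖

/-- `ω` is unital if `ω(ρ)(I - Λ(I)) = ρ(I)` for all `ρ`. -/
def IsUnital : Prop :=
  ∀ ρ : predual K, (ω ρ).1 ⟨1 - Lam 1, one_sub_Lam_mem K⟩ = ρ.1 1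

/-- `π₀` is the normal spine of `ω`: a normal completely positive contraction such that
`π_t^#(A) → π₀(A)` `σ`-strongly as `t → 0+`, for all `A` in `⋃_{s > 0} S_s 𝔅 S_s^*`. -/
structure IsNormalSpine (π₀ : (HalfL2 K →L[ℂ] HalfL2 K) →L[ℂ] (K →L[ℂ] K)) : Prop where
  normal : ∀ ρ ∈ predual K, ρ ∘L π₀ ∈ predual (HalfL2 K)
  cp : IsCP π₀.toLinearMap
  contraction : ‖π₀‖ ≤ 1
  tendsto : ∀ (s : ℝ≥0), 0 < s → ∀ A : HalfL2 K →L[ℂ] HalfL2 K,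
    TendstoSigmaStrong
      (fun t : Ioi (0 : ℝ≥0) =>
        ω.bdryRep (mem_Ioi.1 t.2) (shift s * A * ContinuousLinearMap.adjoint (shift s)))
      (comap Subtype.val (𝓝[>] (0 : ℝ≥0)))
      (π₀ (shift s * A * ContinuousLinearMap.adjoint (shift s)))

/-- The normal spine of `ω` is the zero map. -/
def HasTrivialNormalSpine : Prop := ω.IsNormalSpine 0

/-- `η ≤_q ω` for `q`-weight maps: the differences of the generalized boundary representations
are completely positive. -/
def QSubordinate (η ω : BoundaryWeightMap K) : Prop :=
  ∀ (t : ℝ≥0) (ht : 0 < t), IsCP (ω.bdryRep ht - η.bdryRep ht)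

/-- `ω` is `q`-pure: its set of `q`-subordinates is totally ordered by `q`-subordination. -/
def IsQPure : Prop :=
  ∀ η₁ η₂ : BoundaryWeightMap K, η₁.IsQWeightMap → η₂.IsQWeightMap →
    QSubordinate η₁ ω → QSubordinate η₂ ω → QSubordinate η₁ η₂ ∨ QSubordinate η₂ η₁

end BoundaryWeightMap

end Weights

end QWeight

end

/-! Write `ω̆` for the dualized map. Duality turns the definition of `π̂_t` into `ω̆(EBE) = (1 +
X_t)(π_t^#(B))` with `E = E(t,∞)` and `X_t(A) = ω̆(EΛ(A)E)`. Solving gives two identities: `π_t^#(B)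
= ω̆(E(B - Λ(π_t^#(B)))E)`, so `π_t^#` takes values in the range of `ω̆`; and `π_t^#(B) = A -
π_t^#(Λ(A))` with `A = ω̆(EBE)`. If `B` is supported on `(s,∞)` and `t → 0+`, triviality of the
spine kills the left side of the second identity. Hence any limit point `L` of the maps `π_t^# ∘ Λ`
fixes the range of `ω̆`, and by the first identity it maps into that range: `L` is a completely
positive projection of the `2 × 2` matrices onto the range (`exists_projection`).

Rank 3 is impossible because then `I - L` has the form `X ↦ f(X)A` with `A` selfadjoint and `f(A) =
1`; a test vector diagonal in the eigenbasis of `A` annihilates the identity map and gives `L` the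
value `-1`, contradicting complete positivity (`finrank_ker_ne_one`).

Rank 2 contradicts `q`-purity in the unital case. The range is then a two-dimensional selfadjoint
space containing `I`, so it is diagonal in an orthonormal basis `u, v`, and `ω` amounts to two
boundary weights `ω_u, ω_v`. Let `k` be the supremum over `t` of the ratios `κ_t` for which Cramer's
rule gives `ω_u|_t ≥ κ_t ω_v|_t`. Then `ω_u - kω_v` is a positive weight, and placing it on the line
of `u` yields a `q`-subordinate (`IsDiagonal.exists_subordinate`); the same construction works with
`u` and `v` exchanged. Subordinates on orthogonal lines are comparable only if one of them is zero,
which makes `ω_u` and `ω_v` proportional and the rank at most 1. -/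

noncomputable section

namespace QWeight

/-! ### Positivity of operator matrices, and completely positive maps -/

section Positivity

variable {H K : Type*} [NormedAddCommGroup H] [InnerProductSpace ℂ H] [CompleteSpace H]
  [NormedAddCommGroup K] [InnerProductSpace ℂ K] [CompleteSpace K]

theorem exists_eq_star_mul_self {A : Type*} [NonUnitalCStarAlgebra A] [PartialOrder A]
    [StarOrderedRing A] {a : A} (ha : 0 ≤ a) : ∃ b, a = star b * b :=
  CStarAlgebra.nonneg_iff_eq_star_mul_self.1 ha

theorem inner_self_nonneg_complex (x : H) : 0 ≤ ⟪x, x⟫_ℂ := by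
  rw [inner_self_eq_norm_sq_to_K]
  positivity

theorem nonneg_iff_inner (T : H →L[ℂ] H) : 0 ≤ T ↔ ∀ x, 0 ≤ ⟪x, T x⟫_ℂ := by
  rw [ContinuousLinearMap.nonneg_iff_isPositive]
  refine ⟨fun h x => h.inner_nonneg_right x, fun h => ?_⟩
  rw [← ContinuousLinearMap.isPositive_toLinearMap_iff, LinearMap.isPositive_iff_complex]
  intro x
  have h1 : ⟪T x, x⟫_ℂ = ⟪x, T x⟫_ℂ := by
    rw [← inner_conj_symm]
    exact (h x).star_eq
  have h2 := Complex.nonneg_iff.1 (h x)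
  rw [ContinuousLinearMap.coe_coe, h1]
  exact ⟨Complex.ext rfl h2.2, h2.1⟩

/-- With `T = W*W` the double sum becomes `∑ k, ‖∑ j, W k j (y j)‖²`. -/
theorem cstarMatrix_sum_inner_nonneg {n : ℕ} {T : CStarMatrix (Fin n) (Fin n) (H →L[ℂ] H)}
    (hT : 0 ≤ T) (y : Fin n → H) : 0 ≤ ∑ i, ∑ j, ⟪y i, T i j (y j)⟫_ℂ := by
  obtain ⟨W, rfl⟩ := exists_eq_star_mul_self hT
  have : ∑ i, ∑ j, ⟪y i, (star W * W) i j (y j)⟫_ℂ =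
      ∑ k, ⟪∑ i, W k i (y i), ∑ j, W k j (y j)⟫_ℂ := by
    simp only [CStarMatrix.mul_apply, CStarMatrix.star_apply, sum_apply,
      inner_sum, sum_inner, mul_apply_eq_comp, ContinuousLinearMap.star_eq_adjoint,
      ContinuousLinearMap.adjoint_inner_right]
    rw [Finset.sum_congr rfl fun i _ => Finset.sum_comm, Finset.sum_comm]
    exact Finset.sum_congr rfl fun k _ => Finset.sum_comm
  rw [this]
  exact Finset.sum_nonneg fun k _ => inner_self_nonneg_complex _

theorem cstarMatrix_sum_smul_nonneg {n : ℕ} {T : CStarMatrix (Fin n) (Fin n) (H →L[ℂ] H)}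
    (hT : 0 ≤ T) (x : Fin n → ℂ) : 0 ≤ ∑ i, ∑ j, (star (x i) * x j) • T i j := by
  rw [nonneg_iff_inner]
  intro v
  have h := cstarMatrix_sum_inner_nonneg hT fun i => x i • v
  refine h.trans_eq ?_
  simp only [sum_apply, inner_sum, smul_apply, inner_smul_right, inner_smul_left, map_smul,
    Complex.star_def]
  exact Finset.sum_congr rfl fun i _ => Finset.sum_congr rfl fun j _ => by ring

/-- A positive semidefinite `G` is a sum of matrices `v v*`, and each `v v* ⊗ S*S` is a square in
the matrix algebra. -/
theorem cstarMatrix_smul_nonneg {n : ℕ} (G : Fin n → Fin n → ℂ)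
    (hG : ∀ x : Fin n → ℂ, 0 ≤ ∑ i, ∑ j, star (x i) * x j * G i j)
    {P : K →L[ℂ] K} (hP : 0 ≤ P) :
    0 ≤ CStarMatrix.ofMatrix (Matrix.of fun i j => G i j • P) := by
  obtain ⟨S, rfl⟩ := exists_eq_star_mul_self hP
  have hpos : (Matrix.of G).PosSemidef := by
    rw [← Matrix.isPositive_toEuclideanLin_iff, LinearMap.isPositive_iff_complex]
    intro x
    have h : 0 ≤ ⟪x, (Matrix.of G).toEuclideanLin x⟫_ℂ := by
      refine (hG x).trans_eq ?_
      simp only [PiLp.inner_apply, Matrix.ofLp_toLpLin, Matrix.toLin'_apply, Matrix.mulVec, dotProduct,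
        Matrix.of_apply, RCLike.inner_apply, Finset.sum_mul, Complex.star_def]
      exact Finset.sum_congr rfl fun i _ => Finset.sum_congr rfl fun j _ => by ring
    have h1 : ⟪(Matrix.of G).toEuclideanLin x, x⟫_ℂ = ⟪x, (Matrix.of G).toEuclideanLin x⟫_ℂ := by
      rw [← inner_conj_symm]
      exact h.star_eq
    have h2 := Complex.nonneg_iff.1 h
    rw [h1]
    exact ⟨Complex.ext rfl h2.2, h2.1⟩
  obtain ⟨m, v, hv⟩ := Matrix.posSemidef_iff_eq_sum_vecMulVec.1 hpos
  have hsum : CStarMatrix.ofMatrix (Matrix.of fun i j => G i j • (star S * S)) =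
      ∑ k, CStarMatrix.ofMatrix (Matrix.of fun i j => (v k i * star (v k j)) • (star S * S)) := by
    refine CStarMatrix.ext fun i j => ?_
    have h1 : G i j = ∑ k, v k i * star (v k j) := by
      have := congrFun (congrFun hv i) j
      simpa [Matrix.sum_apply, Matrix.vecMulVec_apply] using this
    change G i j • (star S * S) = _
    have h2 : ∀ s : Finset (Fin m), (∑ k ∈ s, CStarMatrix.ofMatrix (Matrix.of fun i j =>
        (v k i * star (v k j)) • (star S * S))) i j =
        ∑ k ∈ s, (v k i * star (v k j)) • (star S * S) := by
      intro s
      induction s using Finset.induction_on with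
      | empty => rfl
      | insert a s ha ih => rw [Finset.sum_insert ha, Finset.sum_insert ha, CStarMatrix.add_apply, ih]; rfl
    rw [h2, h1, Finset.sum_smul]
  rw [hsum]
  refine Finset.sum_nonneg fun k _ => ?_
  rcases Nat.eq_zero_or_pos n with rfl | hn
  · exact le_of_eq (CStarMatrix.ext fun i => i.elim0)
  -- `W` has a single nonzero row, so that the product `star W * W` has only one term in each entry.
  let W : CStarMatrix (Fin n) (Fin n) (K →L[ℂ] K) :=
    CStarMatrix.ofMatrix (Matrix.of fun i j => if i = ⟨0, hn⟩ then star (v k j) • S else 0)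
  have : CStarMatrix.ofMatrix (Matrix.of fun i j => (v k i * star (v k j)) • (star S * S)) =
      star W * W := by
    refine CStarMatrix.ext fun i j => ?_
    rw [CStarMatrix.mul_apply, Finset.sum_eq_single ⟨0, hn⟩]
    · simp [W, CStarMatrix.star_apply, CStarMatrix.ofMatrix_apply, smul_smul, mul_comm]
    · intro b _ hb
      simp [W, CStarMatrix.ofMatrix_apply, hb]
    · simp
  rw [this]
  exact star_mul_self_nonneg W

/-- A positive functional times a positive operator is completely positive. -/
theorem isCPOn_smulRight {V : Submodule ℂ (H →L[ℂ] H)} {φ : V →ₗ[ℂ] ℂ}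
    (hφ : ∀ A : V, 0 ≤ (A : H →L[ℂ] H) → 0 ≤ φ A) {P : K →L[ℂ] K} (hP : 0 ≤ P) :
    IsCPOn V (φ.smulRight P) := by
  intro n T hT
  refine cstarMatrix_smul_nonneg (fun i j => φ (T i j)) (fun x => ?_) hP
  have h := hφ (∑ i, ∑ j, (star (x i) * x j) • T i j) (by
    simpa using cstarMatrix_sum_smul_nonneg hT x)
  simpa using h

theorem isCP_smulRight {φ : (H →L[ℂ] H) →ₗ[ℂ] ℂ}
    (hφ : ∀ A : H →L[ℂ] H, 0 ≤ A → 0 ≤ φ A) {P : K →L[ℂ] K} (hP : 0 ≤ P) :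
    IsCP (φ.smulRight P) := by
  refine ⟨⟨φ.smulRight P, fun n T hT => ?_⟩, rfl⟩
  refine cstarMatrix_smul_nonneg (fun i j => φ (T i j)) (fun x => ?_) hP
  have h := hφ _ (cstarMatrix_sum_smul_nonneg hT x)
  simpa using h

theorem IsCP.map_nonneg {Φ : (H →L[ℂ] H) →ₗ[ℂ] (K →L[ℂ] K)} (h : IsCP Φ)
    {A : H →L[ℂ] H} (hA : 0 ≤ A) : 0 ≤ Φ A := by
  obtain ⟨Ψ, rfl⟩ := h
  exact _root_.map_nonneg Ψ hA

theorem IsCP.map_star {Φ : (H →L[ℂ] H) →ₗ[ℂ] (K →L[ℂ] K)} (h : IsCP Φ)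
    (A : H →L[ℂ] H) : Φ (star A) = star (Φ A) :=
  StarHomClass.map_star (PositiveLinearMap.mk₀ Φ fun _ => h.map_nonneg) A

/-- The matrix `(a_i* a_j)` is `W*W`, where the only nonzero row of `W` is `a`. -/
theorem IsCP.sum_inner_nonneg {Φ : (H →L[ℂ] H) →ₗ[ℂ] (K →L[ℂ] K)} (h : IsCP Φ) {n : ℕ}
    (a : Fin n → (H →L[ℂ] H)) (y : Fin n → K) :
    0 ≤ ∑ i, ∑ j, ⟪y i, Φ (star (a i) * a j) (y j)⟫_ℂ := by
  rcases Nat.eq_zero_or_pos n with rfl | hn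
  · simp
  obtain ⟨Ψ, rfl⟩ := h
  let W : CStarMatrix (Fin n) (Fin n) (H →L[ℂ] H) :=
    CStarMatrix.ofMatrix (Matrix.of fun i j => if i = ⟨0, hn⟩ then a j else 0)
  have h1 := cstarMatrix_sum_inner_nonneg
    (Ψ.map_cstarMatrix_nonneg' n (star W * W) (star_mul_self_nonneg W)) y
  have h2 : ∀ i j, (star W * W) i j = star (a i) * a j := by
    intro i j
    rw [CStarMatrix.mul_apply, Finset.sum_eq_single ⟨0, hn⟩]
    · simp [W, CStarMatrix.star_apply, CStarMatrix.ofMatrix_apply]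
    · intro b _ hb
      simp [W, CStarMatrix.ofMatrix_apply, hb]
    · simp
  simpa only [CStarMatrix.map_apply, h2] using h1

/-- A positive functional on `𝔅(H)` is bounded by its value at the identity. -/
theorem norm_apply_le_of_positive {φ : (H →L[ℂ] H) →ₗ[ℂ] ℂ}
    (hφ : ∀ A : H →L[ℂ] H, 0 ≤ A → 0 ≤ φ A) (A : H →L[ℂ] H) : ‖φ A‖ ≤ (φ 1).re * ‖A‖ := by
  let f : (H →L[ℂ] H) →ₚ[ℂ] ℂ := PositiveLinearMap.mk₀ φ hφ
  -- Cauchy–Schwarz for the GNS form `(A, B) ↦ φ(A*B)`, applied to `1` and `A`.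
  have h1 : ‖φ A‖ ≤ ‖f.toPreGNS 1‖ * ‖f.toPreGNS A‖ := by
    have := norm_inner_le_norm (𝕜 := ℂ) (f.toPreGNS 1) (f.toPreGNS A)
    rw [f.preGNS_inner_def] at this
    refine le_trans (le_of_eq ?_) this
    change _ = ‖φ (star 1 * A)‖
    simp
  have hs : ∀ B, ‖f.toPreGNS B‖ ^ 2 = (φ (star B * B)).re := by
    intro B
    have := congrArg Complex.re (f.preGNS_norm_sq (f.toPreGNS B))
    rw [← Complex.ofReal_pow, Complex.ofReal_re] at this
    exact this
  have h2 : ‖f.toPreGNS A‖ ^ 2 ≤ ‖A‖ ^ 2 * (φ 1).re := by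
    rw [hs]
    have h3 : 0 ≤ (((‖A‖ ^ 2 : ℝ) : ℂ) • (1 : H →L[ℂ] H)) - star A * A := by
      rw [nonneg_iff_inner]
      intro x
      simp only [sub_apply, smul_apply, inner_sub_right,
        one_apply_eq_self, inner_smul_right, mul_apply_eq_comp,
        ContinuousLinearMap.star_eq_adjoint, ContinuousLinearMap.adjoint_inner_right,
        inner_self_eq_norm_sq_to_K]
      have h4 : ‖A x‖ ^ 2 ≤ ‖A‖ ^ 2 * ‖x‖ ^ 2 := by
        rw [← mul_pow]; gcongr; exact A.le_opNorm x
      rw [sub_nonneg]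
      have := Complex.real_le_real.2 h4
      push_cast at this ⊢
      exact this
    have h5 := (Complex.nonneg_iff.1 (hφ _ h3)).1
    rw [map_sub, map_smul, smul_eq_mul, Complex.sub_re, Complex.re_ofReal_mul] at h5
    linarith
  have h6 : ‖f.toPreGNS 1‖ ^ 2 = (φ 1).re := by rw [hs]; simp
  have h0 : 0 ≤ (φ 1).re := h6 ▸ sq_nonneg _
  refine h1.trans ?_
  refine abs_le_of_sq_le_sq' ?_ (by positivity) |>.2
  rw [mul_pow, h6]
  nlinarith [h2]

end Positivity

/-! ### Compressions to `(t,∞)` and their limit as `t → 0+` -/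

section Compression

variable {K : Type*} [NormedAddCommGroup K] [InnerProductSpace ℂ K] [CompleteSpace K]

theorem E_star (t : ℝ≥0) : star (E (K := K) t) = E t := by
  simp [E, ← ContinuousLinearMap.star_eq_adjoint]

theorem E_mul_E {s t : ℝ≥0} (h : s ≤ t) : E (K := K) s * E t = E t := by
  rw [E_eq, E_eq]
  refine mulOp_mul _ _ _ _ _ _ fun x _ => ?_
  by_cases hx : x ∈ Ioi (t : ℝ)
  · have hs : x ∈ Ioi (s : ℝ) := lt_of_le_of_lt (NNReal.coe_le_coe.2 h) hx
    simp [indicator_of_mem hx, indicator_of_mem hs]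
  · simp [indicator_of_notMem hx]

theorem E_mul_E' {s t : ℝ≥0} (h : s ≤ t) : E (K := K) t * E s = E t := by
  have := congrArg star (E_mul_E (K := K) h)
  simpa [E_star] using this

theorem E_mul_R (t : ℝ≥0) : E t * R K = R K * E t := by
  have hm : MemLp (fun x : ℝ => (((Ioi (t : ℝ)).indicator (fun x => √(1 - Real.exp (-x))) x : ℝ) : ℂ))
      ∞ halfLine := by
    refine memLp_of_le_one _ (Measurable.indicator (by fun_prop) measurableSet_Ioi) fun x hx => ?_
    by_cases h : x ∈ Ioi (t : ℝ)
    · rw [indicator_of_mem h, Real.norm_of_nonneg (Real.sqrt_nonneg _)]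
      exact Real.sqrt_le_one.2 (one_sub_exp_mem hx).2
    · simp [indicator_of_notMem h]
  rw [R_eq, E_eq, mulOp_mul _ _ _ _ _ hm, mulOp_mul _ _ _ _ _ hm]
  all_goals
    intro x _
    by_cases h : x ∈ Ioi (t : ℝ)
    · simp [indicator_of_mem h]
    · simp [indicator_of_notMem h]

theorem E_apply (t : ℝ≥0) (f : HalfL2 K) :
    E t f =ᵐ[halfLine] (Ioi (t : ℝ)).indicator f := by
  rw [E_eq]
  filter_upwards [mulOp_apply _ (memLp_indicator t (fun _ => 1) measurable_const 1 (by simp)) f]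
    with x hx
  rw [hx]
  by_cases h : x ∈ Ioi (t : ℝ)
  · simp [indicator_of_mem h]
  · simp [indicator_of_notMem h]

theorem norm_E_le (t : ℝ≥0) : ‖E (K := K) t‖ ≤ 1 := by
  have h : ‖shift (K := K) t‖ ≤ 1 :=
    ContinuousLinearMap.opNorm_le_bound _ zero_le_one fun f => by rw [norm_shift, one_mul]
  refine (norm_mul_le _ _).trans ?_
  rw [LinearIsometryEquiv.norm_map]
  exact mul_le_one₀ h (norm_nonneg _) h

theorem norm_E_mul_mul_E_le (t : ℝ≥0) (A : HalfL2 K →L[ℂ] HalfL2 K) :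
    ‖E t * A * E t‖ ≤ ‖A‖ := by
  have h := norm_E_le (K := K) t
  calc ‖E t * A * E t‖ ≤ ‖E (K := K) t‖ * ‖A‖ * ‖E (K := K) t‖ :=
        (norm_mul_le _ _).trans (mul_le_mul_of_nonneg_right (norm_mul_le _ _) (norm_nonneg _))
    _ ≤ 1 * ‖A‖ * 1 := by gcongr
    _ = ‖A‖ := by ring

theorem E_conj_nonneg (t : ℝ≥0) {A : HalfL2 K →L[ℂ] HalfL2 K} (hA : 0 ≤ A) :
    0 ≤ E t * A * E t := by
  have := star_left_conjugate_nonneg hA (E (K := K) t)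
  rwa [E_star] at this

/-- Since `E` is a projection, `‖E f - f‖² = ‖f‖² - (f, E f)`, and dominated convergence applies to
the integral of `‖f‖²` over `(t,∞)`. -/
theorem tendsto_E_apply (f : HalfL2 K) :
    Tendsto (fun t : ℝ≥0 => E t f) (𝓝[>] 0) (𝓝 f) := by
  rw [tendsto_iff_norm_sub_tendsto_zero]
  have hsq : ∀ t : ℝ≥0, ‖E t f - f‖ ^ 2 = ‖f‖ ^ 2 - (⟪f, E t f⟫_ℂ).re := by
    intro t
    have h1 : ⟪E t f, E t f⟫_ℂ = ⟪f, E t f⟫_ℂ := by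
      rw [← ContinuousLinearMap.adjoint_inner_right, ← ContinuousLinearMap.star_eq_adjoint, E_star,
        ← mul_apply_eq_comp, E_mul_E le_rfl]
    have h2 : ‖E t f‖ ^ 2 = (⟪f, E t f⟫_ℂ).re := by
      rw [← h1]
      exact (inner_self_eq_norm_sq (𝕜 := ℂ) (E t f)).symm
    have h3 := norm_sub_sq (𝕜 := ℂ) (E t f) f
    have h4 : RCLike.re ⟪E t f, f⟫_ℂ = (⟪f, E t f⟫_ℂ).re := inner_re_symm _ _
    rw [h3, h4, h2]
    ring
  have hE : ∀ t : ℝ≥0, ⟪f, E t f⟫_ℂ =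
      ∫ x, (Ioi (t : ℝ)).indicator (fun x => ⟪f x, f x⟫_ℂ) x ∂halfLine := by
    intro t
    rw [HalfL2.inner_def]
    refine integral_congr_ae ?_
    filter_upwards [E_apply t f] with x hx
    rw [hx]
    by_cases h : x ∈ Ioi (t : ℝ)
    · simp [indicator_of_mem h]
    · simp [indicator_of_notMem h]
  have hlim : Tendsto (fun t : ℝ≥0 => ⟪f, E t f⟫_ℂ) (𝓝[>] 0) (𝓝 ⟪f, f⟫_ℂ) := by
    simp only [hE]
    rw [HalfL2.inner_def]
    refine tendsto_integral_filter_of_dominated_convergence (fun x => ‖f x‖ ^ 2) ?_ ?_ ?_ ?_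
    · exact Eventually.of_forall fun t =>
        (f.memLp.aestronglyMeasurable.inner f.memLp.aestronglyMeasurable).indicator
          measurableSet_Ioi
    · refine Eventually.of_forall fun t => Eventually.of_forall fun x => ?_
      rw [sq]
      exact (norm_indicator_le_norm_self _ _).trans (norm_inner_le_norm _ _)
    · exact f.memLp.integrable_norm_pow two_ne_zero
    · filter_upwards [ae_restrict_mem measurableSet_Ioi] with x hx
      refine tendsto_const_nhds.congr' ?_
      have : ∀ᶠ t : ℝ≥0 in 𝓝[>] 0, (t : ℝ) < x :=
        (((NNReal.continuous_coe.tendsto 0).mono_left nhdsWithin_le_nhds).eventually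
          (Iio_mem_nhds (by simpa using hx)))
      filter_upwards [this] with t ht
      rw [indicator_of_mem (mem_Ioi.2 ht)]
  have h2 : Tendsto (fun t : ℝ≥0 => ‖E t f - f‖ ^ 2) (𝓝[>] 0) (𝓝 0) := by
    simp only [hsq]
    have h3 := (Complex.continuous_re.tendsto _).comp hlim
    have h4 : (⟪f, f⟫_ℂ).re = ‖f‖ ^ 2 := inner_self_eq_norm_sq (𝕜 := ℂ) f
    rw [h4] at h3
    have h5 := h3.const_sub (‖f‖ ^ 2)
    rwa [sub_self] at h5
  have h3 := (Real.continuous_sqrt.tendsto _).comp h2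
  simpa [Function.comp_def, Real.sqrt_sq] using h3

/-- Vector functionals converge because `E(t,∞) → I` strongly. The bound `‖E A E‖ ≤ ‖A‖`, uniform in
`t`, carries this over to norm limits. -/
theorem tendsto_normal_E {ℓ : StrongDual ℂ (HalfL2 K →L[ℂ] HalfL2 K)} (hℓ : ℓ ∈ predual (HalfL2 K))
    (A : HalfL2 K →L[ℂ] HalfL2 K) :
    Tendsto (fun t : ℝ≥0 => ℓ (E t * A * E t)) (𝓝[>] 0) (𝓝 (ℓ A)) := by
  have hspan : ∀ m ∈ Submodule.span ℂ (range fun p : HalfL2 K × HalfL2 K => vecFunctional p.1 p.2),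
      Tendsto (fun t : ℝ≥0 => m (E t * A * E t)) (𝓝[>] 0) (𝓝 (m A)) := by
    intro m hm
    induction hm using Submodule.span_induction with
    | mem m hm =>
      obtain ⟨⟨f, g⟩, rfl⟩ := hm
      have h1 : ∀ t : ℝ≥0, vecFunctional f g (E t * A * E t) = ⟪E t f, A (E t g)⟫_ℂ := by
        intro t
        rw [vecFunctional_apply, ← ContinuousLinearMap.adjoint_inner_right,
          ← ContinuousLinearMap.star_eq_adjoint, E_star]
        rfl
      simp only [h1]
      exact (tendsto_E_apply f).inner ((A.continuous.tendsto _).comp (tendsto_E_apply g))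
    | zero => simp
    | add m n _ _ hm hn => exact hm.add hn
    | smul c m _ hm => exact hm.const_smul c
  rw [Metric.tendsto_nhds]
  intro ε hε
  have hδ : 0 < ε / (3 * (‖A‖ + 1)) := by positivity
  obtain ⟨m, hm, hdist⟩ := Metric.mem_closure_iff.1
    (show ℓ ∈ closure (Submodule.span ℂ
      (range fun p : HalfL2 K × HalfL2 K => vecFunctional p.1 p.2) : Set _) from hℓ) _ hδ
  rw [dist_eq_norm] at hdist
  have hb : ∀ B : HalfL2 K →L[ℂ] HalfL2 K, ‖B‖ ≤ ‖A‖ → ‖ℓ B - m B‖ ≤ ε / 3 := by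
    intro B hB
    calc ‖ℓ B - m B‖ = ‖(ℓ - m) B‖ := rfl
      _ ≤ ‖ℓ - m‖ * ‖B‖ := (ℓ - m).le_opNorm B
      _ ≤ ε / (3 * (‖A‖ + 1)) * (‖A‖ + 1) := by gcongr; linarith
      _ = ε / 3 := by field_simp
  filter_upwards [Metric.tendsto_nhds.1 (hspan m hm) (ε / 3) (by positivity)] with t ht
  rw [dist_eq_norm] at ht ⊢
  have h1 := hb _ (norm_E_mul_mul_E_le t A)
  have h2 := hb A le_rfl
  calc ‖ℓ (E t * A * E t) - ℓ A‖
      = ‖(ℓ (E t * A * E t) - m (E t * A * E t)) + (m (E t * A * E t) - m A) - (ℓ A - m A)‖ := by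
        congr 1; ring
    _ ≤ ‖ℓ (E t * A * E t) - m (E t * A * E t)‖ + ‖m (E t * A * E t) - m A‖ + ‖ℓ A - m A‖ :=
        (norm_sub_le _ _).trans (add_le_add_left (norm_add_le _ _) _)
    _ < ε := by linarith

/-- The filter `t → 0+` on the positive reals. -/
abbrev zeroPlus : Filter (Ioi (0 : ℝ≥0)) := comap Subtype.val (𝓝[>] (0 : ℝ≥0))

instance : zeroPlus.NeBot := by
  rw [comap_neBot_iff]
  intro s hs
  have h : s ∩ Ioi 0 ∈ 𝓝[>] (0 : ℝ≥0) := inter_mem hs self_mem_nhdsWithin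
  obtain ⟨x, hx⟩ := (inferInstance : (𝓝[>] (0 : ℝ≥0)).NeBot).nonempty_of_mem h
  exact ⟨⟨x, hx.2⟩, hx.1⟩

theorem eventually_zeroPlus_le {t : ℝ≥0} (ht : 0 < t) : ∀ᶠ s in zeroPlus, s.1 ≤ t := by
  have : ∀ᶠ s in 𝓝[>] (0 : ℝ≥0), s ≤ t := nhdsWithin_le_nhds (Iic_mem_nhds ht)
  exact this.comap _

/-- The compression of an element of the boundary algebra to `(t,∞)`. -/
def cut {t : ℝ≥0} (ht : 0 < t) : (HalfL2 K →L[ℂ] HalfL2 K) →ₗ[ℂ] boundaryAlgebra K :=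
  (ContinuousLinearMap.mulLeftRight ℂ _ (E (K := K) t) (E t)).toLinearMap.codRestrict
    (boundaryAlgebra K) (E_mul_mul_E_mem ht)

theorem coe_cut {t : ℝ≥0} (ht : 0 < t) (B : HalfL2 K →L[ℂ] HalfL2 K) :
    (cut ht B : HalfL2 K →L[ℂ] HalfL2 K) = E t * B * E t := rfl

theorem cut_cut {s t : ℝ≥0} (hs : 0 < s) (ht : 0 < t) (h : s ≤ t)
    (B : HalfL2 K →L[ℂ] HalfL2 K) : cut hs (cut ht B) = cut ht B := by
  refine Subtype.ext ?_
  simp only [coe_cut]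
  calc E s * (E t * B * E t) * E s = (E s * E t) * B * (E t * E s) := by noncomm_ring
    _ = _ := by rw [E_mul_E h, E_mul_E' h]

/-- As `E(t,∞)` commutes with `(I - Λ(I))^{1/2}`, compressing an element of the boundary algebra
compresses its middle factor, on which the weight is a normal functional. Boundary weights are thus
determined by their truncations. -/
theorem tendsto_cut {μ : Module.Dual ℂ (boundaryAlgebra K)} (hμ : μ ∈ boundaryWeights K)
    (B : boundaryAlgebra K) :
    Tendsto (fun t : Ioi (0 : ℝ≥0) => μ (cut (mem_Ioi.1 t.2) B)) zeroPlus (𝓝 (μ B)) := by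
  obtain ⟨ℓ, hℓ, h⟩ := hμ
  obtain ⟨_, A, rfl⟩ := B
  have h1 : ∀ t : Ioi (0 : ℝ≥0), μ (cut (mem_Ioi.1 t.2) (conjR K A)) = ℓ (E t.1 * A * E t.1) := by
    intro t
    rw [h]
    refine congrArg μ (Subtype.ext ?_)
    change E t.1 * (R K * A * R K) * E t.1 = R K * (E t.1 * A * E t.1) * R K
    calc E t.1 * (R K * A * R K) * E t.1 = (E t.1 * R K) * A * (R K * E t.1) := by noncomm_ring
      _ = (R K * E t.1) * A * (E t.1 * R K) := by rw [E_mul_R]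
      _ = _ := by noncomm_ring
  have h2 := (tendsto_normal_E hℓ A).comp (tendsto_comap (f := (Subtype.val : Ioi (0 : ℝ≥0) → ℝ≥0)))
  rw [h A] at h2
  exact h2.congr fun t => (h1 t).symm

end Compression

/-! ### Factorization and positivity of `Λ` -/

section LamLemmas

variable {K : Type*} [NormedAddCommGroup K] [InnerProductSpace ℂ K] [CompleteSpace K]

theorem memLp_exp_half : MemLp (fun x : ℝ => ((Real.exp (-x / 2) : ℝ) : ℂ)) ∞ halfLine :=
  memLp_of_le_one _ (by fun_prop) fun x hx => by
    rw [Real.norm_of_nonneg (Real.exp_pos _).le]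
    exact Real.exp_le_one_iff.2 (by have := mem_Ioi.1 hx; linarith)

/-- `f ↦ e^{-x/2} A f(x)`. -/
def LamHalf (A : K →L[ℂ] K) : HalfL2 K →L[ℂ] HalfL2 K :=
  mulOp (fun x => ((Real.exp (-x / 2) : ℝ) : ℂ)) memLp_exp_half ∘L ampl A

theorem LamHalf_apply (A : K →L[ℂ] K) (f : HalfL2 K) :
    LamHalf A f =ᵐ[halfLine] fun x => ((Real.exp (-x / 2) : ℝ) : ℂ) • A (f x) := by
  filter_upwards [mulOp_apply (K := K) _ memLp_exp_half (ampl A f), ampl_apply A f] with x h1 h2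
  rw [← h2]
  exact h1

/-- Splitting `e^{-x}` into two factors `e^{-x/2}` puts `Λ(a_i* a_j)` in the form needed by
`IsCP.sum_inner_nonneg`, so `π_t^# ∘ Λ` inherits complete positivity. -/
theorem Lam_star_mul (a b : K →L[ℂ] K) : Lam (star a * b) = star (LamHalf a) * LamHalf b := by
  ext1 g
  refine ext_inner_left ℂ fun f => ?_
  rw [mul_apply_eq_comp, ContinuousLinearMap.star_eq_adjoint (LamHalf a),
    ContinuousLinearMap.adjoint_inner_right, HalfL2.inner_def, HalfL2.inner_def]
  refine integral_congr_ae ?_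
  filter_upwards [Lam_apply (star a * b) g, LamHalf_apply a f, LamHalf_apply b g] with x h1 h2 h3
  rw [h1, h2, h3, inner_smul_right, inner_smul_left, inner_smul_right, mul_apply_eq_comp,
    ContinuousLinearMap.star_eq_adjoint, ContinuousLinearMap.adjoint_inner_right,
    Complex.conj_ofReal, ← mul_assoc, ← Complex.ofReal_mul, ← Real.exp_add]
  congr 4
  ring

theorem Lam_star (a : K →L[ℂ] K) : Lam (star a) = star (Lam a) := by
  have h1 := Lam_star_mul a 1
  have h2 := Lam_star_mul 1 a
  rw [mul_one] at h1
  rw [star_one, one_mul] at h2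
  rw [h1, h2, star_mul, star_star]

theorem Lam_nonneg {a : K →L[ℂ] K} (ha : 0 ≤ a) : 0 ≤ Lam a := by
  obtain ⟨s, rfl⟩ := exists_eq_star_mul_self ha
  rw [Lam_star_mul]
  exact star_mul_self_nonneg _

theorem one_sub_Lam_nonneg : (0 : HalfL2 K →L[ℂ] HalfL2 K) ≤ 1 - Lam 1 := by
  rw [← R_mul_R]
  have h : IsSelfAdjoint (R K) := IsSelfAdjoint.of_nonneg (CFC.sqrt_nonneg _)
  exact h.mul_self_nonneg

theorem Lam_mul_E (a : K →L[ℂ] K) (t : ℝ≥0) : Lam a * E t = E t * Lam a := by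
  ext1 f
  refine HalfL2.ext ?_
  filter_upwards [Lam_apply a (E t f), E_apply t f, E_apply t (Lam a f), Lam_apply a f]
    with x h1 h2 h3 h4
  refine h1.trans (Eq.trans ?_ h3.symm)
  rw [h2]
  by_cases h : x ∈ Ioi (t : ℝ)
  · rw [indicator_of_mem h, indicator_of_mem h, h4]
  · rw [indicator_of_notMem h, indicator_of_notMem h, map_zero, smul_zero]

end LamLemmas

/-! ### The equations for the generalized boundary representation, and the limit projection -/

namespace BoundaryWeightMap

variable {K : Type*} [NormedAddCommGroup K] [InnerProductSpace ℂ K] [CompleteSpace K]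
  [FiniteDimensional ℂ K]

theorem eq_of_predual {A B : K →L[ℂ] K} (h : ∀ ρ : predual K, ρ.1 A = ρ.1 B) : A = B :=
  (evalPredual K).injective (LinearMap.ext h)

variable (ω : BoundaryWeightMap K)

/-- The map `A ↦ ω̆ (E(t,∞) Λ(A) E(t,∞))`, dual to `Λ̂ ω|_t`. -/
def cross {t : ℝ≥0} (ht : 0 < t) : (K →L[ℂ] K) →ₗ[ℂ] (K →L[ℂ] K) :=
  ω.dualized ∘ₗ cut ht ∘ₗ Lam

theorem cross_apply {t : ℝ≥0} (ht : 0 < t) (A : K →L[ℂ] K) :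
    ω.cross ht A = ω.dualized (cut ht (Lam A)) := rfl

theorem oneAdd_apply {t : ℝ≥0} (ht : 0 < t) (ρ : predual K) (A : K →L[ℂ] K) :
    (ω.oneAdd ht ρ).1 A = ρ.1 (A + ω.cross ht A) := by
  rw [map_add, cross_apply, dualized_spec]
  rfl

variable {ω}

theorem piHat_oneAdd {t : ℝ≥0} {ht : 0 < t} (h : IsUnit (ω.oneAdd ht)) (ρ : predual K) :
    ω.piHat ht (ω.oneAdd ht ρ) = trunc ht (ω ρ) := by
  have := LinearMap.congr_fun (Ring.inverse_mul_cancel _ h) ρ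
  simp only [piHat, LinearMap.comp_apply]
  exact congrArg (fun ρ => trunc ht (ω ρ)) this

/-- This is the dual form of `π̂_t (I + Λ̂ ω|_t) = ω|_t`. -/
theorem dualized_cut {t : ℝ≥0} {ht : 0 < t} (h : IsUnit (ω.oneAdd ht))
    (B : HalfL2 K →L[ℂ] HalfL2 K) :
    ω.dualized (cut ht B) = ω.bdryRep ht B + ω.cross ht (ω.bdryRep ht B) := by
  refine eq_of_predual fun ρ => ?_
  rw [← oneAdd_apply, bdryRep_spec, piHat_oneAdd h, dualized_spec]
  rfl

/-- The dual of the surjective map `I + Λ̂ ω|_t` is injective. -/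
theorem eq_zero_of_add_cross {t : ℝ≥0} {ht : 0 < t} (h : IsUnit (ω.oneAdd ht)) {A : K →L[ℂ] K}
    (hA : A + ω.cross ht A = 0) : A = 0 := by
  refine eq_of_predual fun ρ => ?_
  obtain ⟨σ, rfl⟩ := ((Module.End.isUnit_iff _).1 h).2 ρ
  rw [oneAdd_apply, hA, map_zero, map_zero]

theorem bdryRep_eq_dualized {t : ℝ≥0} {ht : 0 < t} (h : IsUnit (ω.oneAdd ht))
    (B : HalfL2 K →L[ℂ] HalfL2 K) :
    ω.bdryRep ht B = ω.dualized (cut ht (B - Lam (ω.bdryRep ht B))) := by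
  rw [map_sub, map_sub, dualized_cut h, cross_apply, add_sub_cancel_right]

/-- With `X = ω.cross ht` and `w = ω̆(EBE)` this reads `(1 + X)⁻¹ w = w - (1 + X)⁻¹ X w`; it is
checked after applying the injective map `1 + X`. -/
theorem bdryRep_eq_sub {t : ℝ≥0} {ht : 0 < t} (h : IsUnit (ω.oneAdd ht))
    (B : HalfL2 K →L[ℂ] HalfL2 K) :
    ω.bdryRep ht B = ω.dualized (cut ht B) - ω.bdryRep ht (Lam (ω.dualized (cut ht B))) := by
  refine sub_eq_zero.1 (eq_zero_of_add_cross h ?_)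
  set w := ω.dualized (cut ht B) with hw
  have h1 := dualized_cut h B
  have h2 := dualized_cut h (Lam w)
  rw [← hw] at h1
  rw [← cross_apply] at h2
  simp only [map_sub]
  rw [h2, h1]
  simp only [map_add]
  abel

theorem norm_vecFunctional_le (x y : K) : ‖vecFunctional x y‖ ≤ ‖x‖ * ‖y‖ := by
  refine ContinuousLinearMap.opNorm_le_bound _ (by positivity) fun A => ?_
  rw [vecFunctional_apply]
  calc ‖⟪x, A y⟫_ℂ‖ ≤ ‖x‖ * (‖A‖ * ‖y‖) :=
        (norm_inner_le_norm _ _).trans (by gcongr; exact A.le_opNorm y)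
    _ = _ := by ring

/-- The contraction property of `π̂_t` is dualized by testing on the functional `A ↦ (z, A y)` with
`z = π_t^#(B) y`. -/
theorem IsQWeightMap.norm_bdryRep_le (h : ω.IsQWeightMap) {t : ℝ≥0} (ht : 0 < t)
    (B : HalfL2 K →L[ℂ] HalfL2 K) : ‖ω.bdryRep ht B‖ ≤ ‖B‖ := by
  refine ContinuousLinearMap.opNorm_le_bound _ (norm_nonneg _) fun y => ?_
  set z := ω.bdryRep ht B y
  have h1 : ‖⟪z, z⟫_ℂ‖ ≤ ‖z‖ * ‖y‖ * ‖B‖ := by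
    let ρ : predual K := ⟨vecFunctional z y, vecFunctional_mem z y⟩
    have h2 : ⟪z, z⟫_ℂ = (ω.piHat ht ρ).1 B := (ω.bdryRep_spec ht ρ B)
    rw [h2]
    refine ((ω.piHat ht ρ).1.le_opNorm B).trans ?_
    gcongr
    exact (h.piHat_contraction t ht ρ).trans (norm_vecFunctional_le z y)
  rcases (norm_nonneg z).eq_or_lt with h0 | h0
  · rw [← h0]; positivity
  · have h3 : ‖⟪z, z⟫_ℂ‖ = ‖z‖ * ‖z‖ := by
      rw [inner_self_eq_norm_sq_to_K]
      simp [sq]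
    rw [h3] at h1
    have : ‖z‖ * ‖z‖ ≤ ‖z‖ * (‖B‖ * ‖y‖) := by linarith
    exact le_of_mul_le_mul_left this h0

theorem tendsto_bdryRep_cut (hspine : ω.HasTrivialNormalSpine) {s : ℝ≥0} (hs : 0 < s)
    (B : HalfL2 K →L[ℂ] HalfL2 K) (x : K) :
    Tendsto (fun t : Ioi (0 : ℝ≥0) => ω.bdryRep (mem_Ioi.1 t.2) (cut hs B : HalfL2 K →L[ℂ] HalfL2 K) x)
      zeroPlus (𝓝 0) := by
  have h1 := hspine.tendsto s hs (ContinuousLinearMap.adjoint (shift s) * B * shift s)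
    -- On the sequence `(x, 0, 0, …)`, `σ`-strong convergence reduces to convergence at the vector
    -- `x`.
    (fun n => if n = 0 then x else 0) (by
      refine summable_of_ne_finset_zero (s := {0}) fun n hn => ?_
      simp [Finset.mem_singleton.not.1 hn])
  have h2 : shift s * (ContinuousLinearMap.adjoint (shift s) * B * shift s) *
      ContinuousLinearMap.adjoint (shift s) = (cut hs B : HalfL2 K →L[ℂ] HalfL2 K) := by
    rw [coe_cut, E]
    noncomm_ring
  rw [h2] at h1
  have h3 : ∀ t : Ioi (0 : ℝ≥0), ∑' n : ℕ, ‖(ω.bdryRep (mem_Ioi.1 t.2)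
      (cut hs B : HalfL2 K →L[ℂ] HalfL2 K) - (0 : (HalfL2 K →L[ℂ] HalfL2 K) →L[ℂ] (K →L[ℂ] K))
        (cut hs B : HalfL2 K →L[ℂ] HalfL2 K)) (if n = 0 then x else 0)‖ ^ 2 =
      ‖ω.bdryRep (mem_Ioi.1 t.2) (cut hs B : HalfL2 K →L[ℂ] HalfL2 K) x‖ ^ 2 := by
    intro t
    rw [tsum_eq_single 0]
    · simp
    · intro n hn
      simp [hn]
  simp only [h3] at h1
  have h4 := (Real.continuous_sqrt.tendsto _).comp h1
  rw [tendsto_zero_iff_norm_tendsto_zero]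
  simpa [Function.comp_def, Real.sqrt_sq] using h4

/-- The limit of the maps `π_t^# ∘ Λ` along an ultrafilter is a completely positive projection
onto the range of the dualized map. -/
theorem exists_projection (hω : ω.IsQWeightMap) (hspine : ω.HasTrivialNormalSpine) :
    ∃ L : (K →L[ℂ] K) →ₗ[ℂ] (K →L[ℂ] K),
      (∀ A, L (star A) = star (L A)) ∧
      (∀ (n : ℕ) (a : Fin n → (K →L[ℂ] K)) (y : Fin n → K),
        0 ≤ ∑ i, ∑ j, ⟪y i, L (star (a i) * a j) (y j)⟫_ℂ) ∧
      (∀ A, L A ∈ LinearMap.range ω.dualized) ∧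
      (∀ A ∈ LinearMap.range ω.dualized, L A = A) := by
  let F : Ioi (0 : ℝ≥0) → ((K →L[ℂ] K) →L[ℂ] (K →L[ℂ] K)) := fun t =>
    LinearMap.toContinuousLinearMap (ω.bdryRep (mem_Ioi.1 t.2) ∘ₗ Lam)
  have hF : ∀ t A, F t A = ω.bdryRep (mem_Ioi.1 t.2) (Lam A) := fun t A => rfl
  let LamC : (K →L[ℂ] K) →L[ℂ] (HalfL2 K →L[ℂ] HalfL2 K) := LinearMap.toContinuousLinearMap Lam
  have hb : ∀ t, F t ∈ Metric.closedBall (0 : (K →L[ℂ] K) →L[ℂ] (K →L[ℂ] K)) ‖LamC‖ := by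
    intro t
    rw [mem_closedBall_zero_iff]
    refine ContinuousLinearMap.opNorm_le_bound _ (norm_nonneg _) fun A => ?_
    exact (hω.norm_bdryRep_le _ _).trans (LamC.le_opNorm A)
  have : ProperSpace ((K →L[ℂ] K) →L[ℂ] (K →L[ℂ] K)) := FiniteDimensional.proper ℂ _
  -- The maps `π_t^# ∘ Λ` stay in a ball of a finite-dimensional space, so they converge along any
  -- ultrafilter finer than `t → 0+`.
  let 𝒰 : Ultrafilter (Ioi (0 : ℝ≥0)) := Ultrafilter.of zeroPlus
  have h𝒰 : (𝒰 : Filter _) ≤ zeroPlus := Ultrafilter.of_le _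
  obtain ⟨L, -, hL⟩ := (isCompact_closedBall (0 : (K →L[ℂ] K) →L[ℂ] (K →L[ℂ] K))
    ‖LamC‖).ultrafilter_le_nhds (𝒰.map F)
    (le_principal_iff.2 (mem_map.2 (Eventually.of_forall hb)))
  have hL' : Tendsto F 𝒰 (𝓝 L) := hL
  have hLA : ∀ A, Tendsto (fun t => F t A) 𝒰 (𝓝 (L A)) := fun A =>
    ((ContinuousLinearMap.apply ℂ _ A).continuous.tendsto L).comp hL'
  have hLAx : ∀ A x, Tendsto (fun t => F t A x) 𝒰 (𝓝 (L A x)) := fun A x =>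
    ((ContinuousLinearMap.apply ℂ _ x).continuous.tendsto (L A)).comp (hLA A)
  refine ⟨L.toLinearMap, fun A => ?_, fun n a y => ?_, fun A => ?_, ?_⟩
  · have h1 : Tendsto (fun t => star (F t A)) 𝒰 (𝓝 (star (L A))) :=
      (continuous_star.tendsto _).comp (hLA A)
    refine tendsto_nhds_unique (hLA (star A)) (h1.congr fun t => ?_)
    rw [hF, hF, Lam_star, (hω.piHat_cp _ _).map_star]
  · have h1 : Tendsto (fun t => ∑ i, ∑ j, ⟪y i, F t (star (a i) * a j) (y j)⟫_ℂ) 𝒰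
        (𝓝 (∑ i, ∑ j, ⟪y i, L (star (a i) * a j) (y j)⟫_ℂ)) :=
      tendsto_finsetSum _ fun i _ => tendsto_finsetSum _ fun j _ =>
        tendsto_const_nhds.inner (hLAx _ _)
    refine ge_of_tendsto' h1 fun t => ?_
    simp only [hF, Lam_star_mul]
    exact (hω.piHat_cp _ _).sum_inner_nonneg _ _
  · refine (Submodule.closed_of_finiteDimensional (LinearMap.range ω.dualized)).mem_of_tendsto
      (hLA A) (Eventually.of_forall fun t => ?_)
    exact ⟨_, (bdryRep_eq_dualized (hω.invertible _ _) _).symm⟩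
  · rintro _ ⟨B, rfl⟩
    -- For `t ≤ s` and `A = ω̆` of the truncation of `B` at `s`, `π_t^#` of that truncation equals
    -- `A - π_t^#(Λ(A))`; the trivial spine sends it to `0`.
    have hcut : ∀ s : Ioi (0 : ℝ≥0), L (ω.dualized (cut (mem_Ioi.1 s.2) B)) =
        ω.dualized (cut (mem_Ioi.1 s.2) B) := by
      intro s
      set A := ω.dualized (cut (mem_Ioi.1 s.2) B)
      ext1 x
      have h1 := ((tendsto_bdryRep_cut hspine (mem_Ioi.1 s.2) B x).mono_left h𝒰).add (hLAx A x)
      rw [zero_add] at h1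
      refine tendsto_nhds_unique h1 (tendsto_const_nhds.congr' ?_)
      filter_upwards [h𝒰 (eventually_zeroPlus_le (mem_Ioi.1 s.2))] with t ht
      rw [bdryRep_eq_sub (hω.invertible _ _), cut_cut _ _ ht, hF]
      simp [A]
    refine eq_of_predual fun ρ => ?_
    -- The weight `ω(ρ ∘ (L - id))` vanishes on all truncations of `B`, hence on `B` itself.
    let σ : predual K := ⟨ρ.1 ∘L (L - ContinuousLinearMap.id ℂ _), (predual_eq_top K).symm ▸ Submodule.mem_top⟩
    have h1 := tendsto_cut (ω σ).2 B
    have h2 : ∀ s : Ioi (0 : ℝ≥0), (ω σ).1 (cut (mem_Ioi.1 s.2) B) = 0 := by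
      intro s
      rw [← dualized_spec]
      change ρ.1 (L (ω.dualized _) - ω.dualized _) = 0
      rw [hcut, sub_self, map_zero]
    simp only [h2] at h1
    have h3 := tendsto_nhds_unique h1 tendsto_const_nhds
    rw [← dualized_spec] at h3
    have h4 : ρ.1 (L (ω.dualized B) - ω.dualized B) = 0 := h3
    rw [map_sub, sub_eq_zero] at h4
    exact h4

end BoundaryWeightMap

/-! ### Linear algebra in the `2 × 2` matrices -/

section TwoDim

variable {K : Type*} [NormedAddCommGroup K] [InnerProductSpace ℂ K] [CompleteSpace K]
  [FiniteDimensional ℂ K]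

open InnerProductSpace (rankOne)

theorem exists_eigenbasis {n : ℕ} (hK : Module.finrank ℂ K = n) {A : K →L[ℂ] K}
    (hA : IsSelfAdjoint A) :
    ∃ (b : OrthonormalBasis (Fin n) ℂ K) (a : Fin n → ℂ), ∀ i, A (b i) = a i • b i := by
  have hs : (A : K →ₗ[ℂ] K).IsSymmetric := hA.isSymmetric
  exact ⟨hs.eigenvectorBasis hK, fun i => (hs.eigenvalues hK i : ℂ),
    fun i => hs.apply_eigenvectorBasis hK i⟩

theorem eq_of_orthonormalBasis {ι : Type*} [Fintype ι] (b : OrthonormalBasis ι ℂ K)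
    {S T : K →L[ℂ] K} (h : ∀ i, S (b i) = T (b i)) : S = T := by
  refine ContinuousLinearMap.coe_injective (b.toBasis.ext fun i => ?_)
  simpa using h i

/-- Otherwise `W` would contain the real and imaginary parts of every element of `V`. -/
theorem exists_isSelfAdjoint_notMem {V W : Submodule ℂ (K →L[ℂ] K)}
    (hV : ∀ A ∈ V, star A ∈ V) (h : ¬ V ≤ W) : ∃ A ∈ V, IsSelfAdjoint A ∧ A ∉ W := by
  obtain ⟨X, hX, hXW⟩ := SetLike.not_le_iff_exists.1 h
  by_contra! hc
  have h1 := hc (X + star X) (V.add_mem hX (hV X hX)) (IsSelfAdjoint.add_star_self X)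
  have h2 := hc (Complex.I • (X - star X)) (V.smul_mem _ (V.sub_mem hX (hV X hX))) (by
    rw [isSelfAdjoint_iff, star_smul, star_sub, star_star, Complex.star_def, Complex.conj_I,
      neg_smul, ← smul_neg, neg_sub])
  refine hXW ?_
  have h3 : X = (1 / 2 : ℂ) • (X + star X) + (-Complex.I / 2) • (Complex.I • (X - star X)) := by
    rw [smul_smul]
    have : -Complex.I / 2 * Complex.I = 1 / 2 := by
      linear_combination (-1 / 2 : ℂ) * Complex.I_mul_I
    rw [this]
    module
  rw [h3]
  exact W.add_mem (W.smul_mem _ h1) (W.smul_mem _ h2)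

/-- The kernel of a completely positive projection on the `2 × 2` matrices is not
one-dimensional. -/
theorem finrank_ker_ne_one (hK : Module.finrank ℂ K = 2)
    {L : (K →L[ℂ] K) →ₗ[ℂ] (K →L[ℂ] K)} (hstar : ∀ A, L (star A) = star (L A))
    (hcp : ∀ (n : ℕ) (a : Fin n → (K →L[ℂ] K)) (y : Fin n → K),
      0 ≤ ∑ i, ∑ j, ⟪y i, L (star (a i) * a j) (y j)⟫_ℂ)
    (hL : ∀ A, L (L A) = L A) : Module.finrank ℂ (LinearMap.ker L) ≠ 1 := by
  intro h1
  obtain ⟨A, hA, hAs, hA0⟩ := exists_isSelfAdjoint_notMem (V := LinearMap.ker L) (W := ⊥)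
    (fun A hA => by rw [LinearMap.mem_ker] at hA ⊢; rw [hstar, hA, star_zero])
    (fun h => by rw [le_bot_iff.1 h] at h1; simp at h1)
  have hker : ∀ X ∈ LinearMap.ker L, ∃ c : ℂ, c • A = X := by
    intro X hX
    obtain ⟨c, hc⟩ := (finrank_eq_one_iff_of_nonzero' (⟨A, hA⟩ : LinearMap.ker L)
      (fun h => hA0 (by simpa using congrArg Subtype.val h))).1 h1 ⟨X, hX⟩
    exact ⟨c, congrArg Subtype.val hc⟩
  -- `I - L` takes values in the kernel of `L`, the line spanned by `A`.
  have hf : ∀ X, ∃ c : ℂ, c • A = X - L X := fun X =>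
    hker _ (by rw [LinearMap.mem_ker, map_sub, hL, sub_self])
  choose f hf using hf
  obtain ⟨b, a, hb⟩ := exists_eigenbasis hK hAs
  have hbb : ∀ i j, ⟪b i, b j⟫_ℂ = if i = j then 1 else 0 := orthonormal_iff_ite.1 b.orthonormal
  have hsum : A = a 0 • rankOne ℂ (b 0) (b 0) + a 1 • rankOne ℂ (b 1) (b 1) := by
    refine eq_of_orthonormalBasis b fun i => ?_
    fin_cases i <;> simp [hb, hbb]
  -- This is `f(A) = 1`, which holds because `L A = 0`, expanded in the eigenbasis.
  have hone : a 0 * f (rankOne ℂ (b 0) (b 0)) + a 1 * f (rankOne ℂ (b 1) (b 1)) = 1 := by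
    have h2 : (a 0 * f (rankOne ℂ (b 0) (b 0)) + a 1 * f (rankOne ℂ (b 1) (b 1))) • A = A := by
      rw [add_smul, mul_smul, mul_smul, hf, hf]
      have h3 := congrArg L hsum
      rw [LinearMap.mem_ker.1 hA, map_add, map_smul, map_smul] at h3
      calc _ = (a 0 • rankOne ℂ (b 0) (b 0) + a 1 • rankOne ℂ (b 1) (b 1)) -
            (a 0 • L (rankOne ℂ (b 0) (b 0)) + a 1 • L (rankOne ℂ (b 1) (b 1))) := by module
        _ = A := by rw [← h3, ← hsum, sub_zero]
    have h4 : (a 0 * f (rankOne ℂ (b 0) (b 0)) + a 1 * f (rankOne ℂ (b 1) (b 1)) - 1) • A = 0 := by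
      rw [sub_smul, h2, one_smul, sub_self]
    exact sub_eq_zero.1 ((smul_eq_zero.1 h4).resolve_right hA0)
  have hLe : ∀ i j, L (star (rankOne ℂ (b 0) (b i)) * rankOne ℂ (b 0) (b j)) =
      rankOne ℂ (b i) (b j) - f (rankOne ℂ (b i) (b j)) • A := by
    intro i j
    have : star (rankOne ℂ (b 0) (b i)) * rankOne ℂ (b 0) (b j) = rankOne ℂ (b i) (b j) := by
      refine eq_of_orthonormalBasis b fun k => ?_
      by_cases h : j = k <;> simp [ContinuousLinearMap.star_eq_adjoint, hbb, h]
    rw [this, hf, sub_sub_cancel]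
  -- The operators `star (a i) * a j` are the matrix units `e_ij`. With `y = (b 0, -b 1)` the
  -- identity map contributes `|∑ (y_i, b_i)|² = 0`. Since `A` is diagonal, `f(·)A` contributes only
  -- `a 0 f(e_00) + a 1 f(e_11) = 1`, so the total for `L` is `-1`.
  have h2 := hcp 2 (fun i => rankOne ℂ (b 0) (b i)) ![b 0, -b 1]
  simp only [hLe] at h2
  have h3 : ∑ i, ∑ j, ⟪(![b 0, -b 1] : Fin 2 → K) i, (rankOne ℂ (b i) (b j) -
      f (rankOne ℂ (b i) (b j)) • A) ((![b 0, -b 1] : Fin 2 → K) j)⟫_ℂ = -1 := by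
    rw [← hone]
    simp [Fin.sum_univ_two, hb, hbb, inner_smul_right]
    ring
  rw [h3] at h2
  have := (Complex.nonneg_iff.1 h2).1
  norm_num at this

/-- A two-dimensional selfadjoint space of operators that contains the identity is
simultaneously diagonalizable. -/
theorem exists_diagonal_basis (hK : Module.finrank ℂ K = 2) {V : Submodule ℂ (K →L[ℂ] K)}
    (hone : 1 ∈ V) (hstar : ∀ A ∈ V, star A ∈ V) (hV : Module.finrank ℂ V = 2) :
    ∃ b : OrthonormalBasis (Fin 2) ℂ K, ∀ T ∈ V,
      T = ⟪b 0, T (b 0)⟫_ℂ • rankOne ℂ (b 0) (b 0) + ⟪b 1, T (b 1)⟫_ℂ • rankOne ℂ (b 1) (b 1) := by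
  have hnot : ¬ V ≤ Submodule.span ℂ {1} := by
    intro h
    have h1 := (Submodule.finrank_mono h).trans (finrank_span_le_card _)
    rw [hV] at h1
    simp at h1
  obtain ⟨A, hA, hAs, hA1⟩ := exists_isSelfAdjoint_notMem hstar hnot
  obtain ⟨b, a, hb⟩ := exists_eigenbasis hK hAs
  have hbb : ∀ i j, ⟪b i, b j⟫_ℂ = if i = j then 1 else 0 := orthonormal_iff_ite.1 b.orthonormal
  refine ⟨b, fun T hT => ?_⟩
  have : Nontrivial K := Module.nontrivial_of_finrank_pos (R := ℂ) (by omega)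
  have hli : LinearIndependent ℂ ![(1 : K →L[ℂ] K), A] := by
    rw [LinearIndependent.pair_iff' one_ne_zero]
    exact fun c hc => hA1 (Submodule.mem_span_singleton.2 ⟨c, hc⟩)
  have hspan : Submodule.span ℂ (range ![(1 : K →L[ℂ] K), A]) = V := by
    refine Submodule.eq_of_le_of_finrank_eq ?_ ?_
    · rw [Submodule.span_le]
      rintro _ ⟨i, rfl⟩
      fin_cases i
      · exact hone
      · exact hA
    · rw [finrank_span_eq_card hli, hV, Fintype.card_fin]
  rw [← hspan, Matrix.range_cons, Matrix.range_cons, Matrix.range_empty, union_empty] at hT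
  obtain ⟨α, β, rfl⟩ := Submodule.mem_span_pair.1 hT
  refine eq_of_orthonormalBasis b fun i => ?_
  fin_cases i <;> simp [hb, hbb, add_smul, smul_smul]

end TwoDim

/-! ### Diagonal `q`-weight maps as pairs of weights, and their ratios -/

namespace BoundaryWeightMap

open InnerProductSpace (rankOne)

variable {K : Type*} [NormedAddCommGroup K] [InnerProductSpace ℂ K] [CompleteSpace K]
  [FiniteDimensional ℂ K]

/-- The vector state of `u`. -/
def vecState (u : K) : predual K := ⟨vecFunctional u u, vecFunctional_mem u u⟩

theorem rankOne_self_nonneg (u : K) : 0 ≤ rankOne ℂ u u := by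
  rw [nonneg_iff_inner]
  intro x
  rw [InnerProductSpace.rankOne_apply, inner_smul_right, ← inner_conj_symm u x,
    Complex.conj_mul']
  positivity

theorem rankOne_self_le_one {u : K} (hu : ‖u‖ = 1) : rankOne ℂ u u ≤ 1 := by
  rw [← sub_nonneg, nonneg_iff_inner]
  intro x
  rw [sub_apply, inner_sub_right, InnerProductSpace.rankOne_apply, inner_smul_right,
    ← inner_conj_symm u x, Complex.conj_mul', one_apply_eq_self, inner_self_eq_norm_sq_to_K,
    sub_nonneg]
  have h : ‖⟪x, u⟫_ℂ‖ ^ 2 ≤ ‖x‖ ^ 2 := by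
    have := norm_inner_le_norm (𝕜 := ℂ) x u
    rw [hu, mul_one] at this
    gcongr
  have := Complex.real_le_real.2 h
  push_cast at this
  exact this

variable (ω : BoundaryWeightMap K)

/-- The boundary weight `B ↦ (u, ω̆(B) u)`. -/
def weight (u : K) : boundaryWeights K := ω (vecState u)

theorem weight_apply (u : K) (B : boundaryAlgebra K) :
    (ω.weight u).1 B = ⟪u, ω.dualized B u⟫_ℂ := (ω.dualized_spec (vecState u) B).symm

/-- The functional `B ↦ (u, π_t^#(B) u)`. -/
def repFun {t : ℝ≥0} (ht : 0 < t) (u : K) : (HalfL2 K →L[ℂ] HalfL2 K) →ₗ[ℂ] ℂ :=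
  (vecFunctional u u).toLinearMap ∘ₗ ω.bdryRep ht

theorem repFun_apply {t : ℝ≥0} (ht : 0 < t) (u : K) (B : HalfL2 K →L[ℂ] HalfL2 K) :
    ω.repFun ht u B = ⟪u, ω.bdryRep ht B u⟫_ℂ := rfl

/-- The matrix of the map `Λ̂ ω|_t` on diagonal operators. -/
def coupling {t : ℝ≥0} (ht : 0 < t) (u v : K) : ℝ :=
  ((ω.weight u).1 (cut ht (Lam (rankOne ℂ v v)))).re

variable {ω}

theorem IsQWeightMap.weight_nonneg (h : ω.IsQWeightMap) (u : K) {B : boundaryAlgebra K}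
    (hB : 0 ≤ (B : HalfL2 K →L[ℂ] HalfL2 K)) : 0 ≤ (ω.weight u).1 B := by
  have h1 := h.cp 1 (CStarMatrix.ofMatrix (Matrix.of fun _ _ => B)) (by
    have h2 := cstarMatrix_smul_nonneg (n := 1) (fun _ _ => 1) (fun x => by
      simpa using star_mul_self_nonneg (x 0)) hB
    simp only [one_smul] at h2
    exact h2)
  have h2 := cstarMatrix_sum_inner_nonneg h1 fun _ => u
  rw [weight_apply]
  simpa using h2

theorem IsQWeightMap.weight_cut_nonneg (h : ω.IsQWeightMap) (u : K) {t : ℝ≥0} (ht : 0 < t)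
    {B : HalfL2 K →L[ℂ] HalfL2 K} (hB : 0 ≤ B) : 0 ≤ (ω.weight u).1 (cut ht B) :=
  h.weight_nonneg u (E_conj_nonneg t hB)

theorem IsQWeightMap.coe_coupling (h : ω.IsQWeightMap) {t : ℝ≥0} (ht : 0 < t) (u v : K) :
    (ω.weight u).1 (cut ht (Lam (rankOne ℂ v v))) = ω.coupling ht u v := by
  have := Complex.nonneg_iff.1 (h.weight_cut_nonneg u ht (Lam_nonneg (rankOne_self_nonneg v)))
  exact Complex.ext rfl this.2.symm

theorem IsQWeightMap.coupling_nonneg (h : ω.IsQWeightMap) {t : ℝ≥0} (ht : 0 < t) (u v : K) :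
    0 ≤ ω.coupling ht u v :=
  (Complex.nonneg_iff.1 (h.weight_cut_nonneg u ht (Lam_nonneg (rankOne_self_nonneg v)))).1

theorem IsQWeightMap.repFun_nonneg (h : ω.IsQWeightMap) {t : ℝ≥0} (ht : 0 < t) (u : K)
    {B : HalfL2 K →L[ℂ] HalfL2 K} (hB : 0 ≤ B) : 0 ≤ ω.repFun ht u B :=
  (nonneg_iff_inner _).1 ((h.piHat_cp t ht).map_nonneg hB) u

theorem IsQWeightMap.repFun_one_le (h : ω.IsQWeightMap) {t : ℝ≥0} (ht : 0 < t) {u : K}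
    (hu : ‖u‖ = 1) : (ω.repFun ht u 1).re ≤ 1 := by
  refine (Complex.re_le_norm _).trans ?_
  calc ‖⟪u, ω.bdryRep ht 1 u⟫_ℂ‖ ≤ ‖u‖ * (‖ω.bdryRep ht 1‖ * ‖u‖) :=
        (norm_inner_le_norm _ _).trans (by gcongr; exact ContinuousLinearMap.le_opNorm _ _)
    _ ≤ 1 := by
      rw [hu, one_mul, mul_one]
      exact (h.norm_bdryRep_le ht 1).trans ContinuousLinearMap.norm_id_le

/-- The range of the dualized map of `ω` consists of operators that are diagonal with respect to
the orthonormal pair `u`, `v`. -/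
structure IsDiagonal (ω : BoundaryWeightMap K) (u v : K) : Prop where
  norm_left : ‖u‖ = 1
  norm_right : ‖v‖ = 1
  inner_eq_zero : ⟪u, v⟫_ℂ = 0
  dualized_eq : ∀ B, ω.dualized B =
    (ω.weight u).1 B • rankOne ℂ u u + (ω.weight v).1 B • rankOne ℂ v v

variable {u v : K}

theorem IsDiagonal.symm (hd : ω.IsDiagonal u v) : ω.IsDiagonal v u where
  norm_left := hd.norm_right
  norm_right := hd.norm_left
  inner_eq_zero := inner_eq_zero_symm.1 hd.inner_eq_zero
  dualized_eq B := by rw [add_comm]; exact hd.dualized_eq B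

theorem IsDiagonal.bdryRep_eq (hd : ω.IsDiagonal u v) (h : ω.IsQWeightMap) {t : ℝ≥0} (ht : 0 < t)
    (B : HalfL2 K →L[ℂ] HalfL2 K) :
    ω.bdryRep ht B = ω.repFun ht u B • rankOne ℂ u u + ω.repFun ht v B • rankOne ℂ v v := by
  simp only [repFun_apply]
  rw [bdryRep_eq_dualized (h.invertible t ht), ← weight_apply, ← weight_apply]
  exact hd.dualized_eq _

/-- `dualized_cut` read in the coordinate `u`. With its counterpart for `v` it is a `2 × 2` linear
system for the two functionals of `π_t^#`. -/
theorem IsDiagonal.weight_cut (hd : ω.IsDiagonal u v) (h : ω.IsQWeightMap) {t : ℝ≥0} (ht : 0 < t)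
    (B : HalfL2 K →L[ℂ] HalfL2 K) :
    (ω.weight u).1 (cut ht B) = (1 + ω.coupling ht u u) * ω.repFun ht u B +
      ω.coupling ht u v * ω.repFun ht v B := by
  rw [weight_apply, dualized_cut (h.invertible t ht), cross_apply]
  rw [add_apply, inner_add_right, ← weight_apply, ← repFun_apply, hd.bdryRep_eq h ht B,
    map_add, map_smul, map_smul, map_add, map_smul, map_smul, map_add, map_smul, map_smul,
    h.coe_coupling, h.coe_coupling, smul_eq_mul, smul_eq_mul]
  ring

/-- The largest multiple of the weight of `v` that the weight of `u` dominates after truncation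
at `t`. -/
def ratio (ω : BoundaryWeightMap K) {t : ℝ≥0} (ht : 0 < t) (u v : K) : ℝ :=
  ω.coupling ht u v / (1 + ω.coupling ht v v)

/-- Cramer's rule for the system of `weight_cut`. -/
theorem IsDiagonal.det_mul_repFun (hd : ω.IsDiagonal u v) (h : ω.IsQWeightMap) {t : ℝ≥0}
    (ht : 0 < t) (B : HalfL2 K →L[ℂ] HalfL2 K) :
    (1 + ω.coupling ht v v) * (ω.weight u).1 (cut ht B) -
        ω.coupling ht u v * (ω.weight v).1 (cut ht B) =
      (((1 + ω.coupling ht u u) * (1 + ω.coupling ht v v) -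
        ω.coupling ht u v * ω.coupling ht v u : ℝ) : ℂ) * ω.repFun ht u B := by
  rw [hd.weight_cut h ht, hd.symm.weight_cut h ht]
  push_cast
  ring

/-- Let `D` be the determinant, `c` the coupling of `v` with itself and `r` the value of `repFun` at
`Λ(uu*)`. Cramer's rule at `Λ(uu*)` gives `D - (1 + c) = D r`, that is, `D (1 - r) = 1 + c > 0`; and
`r ≤ 1` because `Λ(uu*) ≤ I`. -/
theorem IsDiagonal.det_pos (hd : ω.IsDiagonal u v) (h : ω.IsQWeightMap) {t : ℝ≥0} (ht : 0 < t) :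
    0 < (1 + ω.coupling ht u u) * (1 + ω.coupling ht v v) -
        ω.coupling ht u v * ω.coupling ht v u := by
  have h1 := congrArg Complex.re (hd.det_mul_repFun h ht (Lam (rankOne ℂ u u)))
  rw [h.coe_coupling, h.coe_coupling] at h1
  rw [Complex.re_ofReal_mul] at h1
  have h2 : (1 + (ω.coupling ht v v : ℂ)) * ω.coupling ht u u -
      ω.coupling ht u v * ω.coupling ht v u =
      (((1 + ω.coupling ht v v) * ω.coupling ht u u -
        ω.coupling ht u v * ω.coupling ht v u : ℝ) : ℂ) := by push_cast; ring
  rw [h2, Complex.ofReal_re] at h1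
  have h3 : 0 ≤ ω.repFun ht u (1 - Lam (rankOne ℂ u u)) := by
    refine h.repFun_nonneg ht u ?_
    have h4 := add_nonneg (one_sub_Lam_nonneg (K := K))
      (Lam_nonneg (sub_nonneg.2 (rankOne_self_le_one hd.norm_left)))
    rwa [map_sub, sub_add_sub_cancel] at h4
  have h4 := (Complex.nonneg_iff.1 h3).1
  rw [map_sub, Complex.sub_re] at h4
  have h5 := h.repFun_one_le ht hd.norm_left
  have h6 := h.coupling_nonneg ht v v
  nlinarith

theorem IsDiagonal.ratio_mul_le (hd : ω.IsDiagonal u v) (h : ω.IsQWeightMap) {t : ℝ≥0}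
    (ht : 0 < t) {B : HalfL2 K →L[ℂ] HalfL2 K} (hB : 0 ≤ B) :
    ω.ratio ht u v * ((ω.weight v).1 (cut ht B)).re ≤ ((ω.weight u).1 (cut ht B)).re := by
  have h1 := congrArg Complex.re (hd.det_mul_repFun h ht B)
  have h2 : (1 + (ω.coupling ht v v : ℂ)) = ((1 + ω.coupling ht v v : ℝ) : ℂ) := by push_cast; ring
  rw [h2, Complex.re_ofReal_mul, Complex.sub_re, Complex.re_ofReal_mul, Complex.re_ofReal_mul] at h1
  have h3 := mul_nonneg (hd.det_pos h ht).le (Complex.nonneg_iff.1 (h.repFun_nonneg ht u hB)).1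
  have h4 : 0 < 1 + ω.coupling ht v v := by linarith [h.coupling_nonneg ht v v]
  rw [ratio, div_mul_eq_mul_div, div_le_iff₀ h4]
  linarith

theorem IsQWeightMap.ratio_nonneg (h : ω.IsQWeightMap) {t : ℝ≥0} (ht : 0 < t) :
    0 ≤ ω.ratio ht u v :=
  div_nonneg (h.coupling_nonneg ht u v) (by linarith [h.coupling_nonneg ht v v])

/-- Domination at level `s` is applied to the part of `Λ(vv*)` on `(0,t)`, which is positive. It
compares the increments of the couplings from `t` to `s`, and the definition of the ratio at `s`
does the rest. -/
theorem IsDiagonal.ratio_antitone (hd : ω.IsDiagonal u v) (h : ω.IsQWeightMap) {s t : ℝ≥0}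
    (hs : 0 < s) (ht : 0 < t) (hst : s ≤ t) : ω.ratio ht u v ≤ ω.ratio hs u v := by
  set X : HalfL2 K →L[ℂ] HalfL2 K := Lam (rankOne ℂ v v)
  have hX : 0 ≤ (1 - E t) * X * (1 - E t) := by
    have h1 := star_left_conjugate_nonneg (Lam_nonneg (rankOne_self_nonneg v))
      (1 - E (K := K) t)
    rwa [star_sub, star_one, E_star] at h1
  have hX' : (1 - E t) * X * (1 - E t) = X - (cut ht X : HalfL2 K →L[ℂ] HalfL2 K) := by
    have h1 : X * E t = E t * X := Lam_mul_E _ t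
    have h2 : E t * X * E t = E t * X := by
      rw [mul_assoc, h1, ← mul_assoc, E_mul_E le_rfl]
    rw [coe_cut]
    calc (1 - E t) * X * (1 - E t) = X - E t * X - X * E t + E t * X * E t := by noncomm_ring
      _ = _ := by rw [h1, h2]; abel
  have h1 := hd.ratio_mul_le h hs hX
  rw [hX', map_sub, cut_cut hs ht hst, map_sub, map_sub, Complex.sub_re, Complex.sub_re] at h1
  have h2 : ω.ratio hs u v * (1 + ω.coupling hs v v) = ω.coupling hs u v :=
    div_mul_cancel₀ _ (by linarith [h.coupling_nonneg hs v v])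
  have h4 : 0 < 1 + ω.coupling ht v v := by linarith [h.coupling_nonneg ht v v]
  change ω.ratio hs u v * (ω.coupling hs v v - ω.coupling ht v v) ≤
    ω.coupling hs u v - ω.coupling ht u v at h1
  rw [ratio, div_le_iff₀ h4]
  linarith

theorem IsDiagonal.ratio_mul_le' (hd : ω.IsDiagonal u v) (h : ω.IsQWeightMap) {s t : ℝ≥0}
    (hs : 0 < s) (ht : 0 < t) {B : HalfL2 K →L[ℂ] HalfL2 K} (hB : 0 ≤ B) :
    ω.ratio hs u v * ((ω.weight v).1 (cut ht B)).re ≤ ((ω.weight u).1 (cut ht B)).re := by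
  rcases le_total s t with hst | hst
  · have h1 := hd.ratio_mul_le h hs (E_conj_nonneg t hB)
    have h2 : cut hs (E t * B * E t) = cut ht B := cut_cut hs ht hst B
    rwa [h2] at h1
  · refine le_trans ?_ (hd.ratio_mul_le h ht hB)
    exact mul_le_mul_of_nonneg_right (hd.ratio_antitone h ht hs hst)
      (Complex.nonneg_iff.1 (h.weight_cut_nonneg v ht hB)).1

theorem IsUnital.weight_one_sub_Lam (hun : ω.IsUnital) (hu : ‖u‖ = 1) :
    (ω.weight u).1 ⟨1 - Lam 1, one_sub_Lam_mem K⟩ = 1 := by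
  refine (hun (vecState u)).trans ?_
  change ⟪u, (1 : K →L[ℂ] K) u⟫_ℂ = 1
  rw [one_apply_eq_self, inner_self_eq_norm_sq_to_K, hu]
  simp

/-- The supremum of the ratios is finite and gives a dominated multiple of the weight of `v`. -/
theorem IsDiagonal.exists_ratio_bound (hd : ω.IsDiagonal u v) (h : ω.IsQWeightMap)
    (hun : ω.IsUnital) :
    ∃ k : ℝ, 0 ≤ k ∧ (∀ (t : ℝ≥0) (ht : 0 < t), ω.ratio ht u v ≤ k) ∧
      ∀ (t : ℝ≥0) (ht : 0 < t) (B : HalfL2 K →L[ℂ] HalfL2 K), 0 ≤ B →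
        k * ((ω.weight v).1 (cut ht B)).re ≤ ((ω.weight u).1 (cut ht B)).re := by
  have hlim := tendsto_cut (ω.weight v).2 ⟨1 - Lam 1, one_sub_Lam_mem K⟩
  rw [hun.weight_one_sub_Lam hd.norm_right] at hlim
  have hre := (Complex.continuous_re.tendsto _).comp hlim
  -- By unitality the truncated values tend to `1`, so one of them is positive. Domination at that
  -- truncation bounds all ratios.
  obtain ⟨t₀, ht₀⟩ := (hre.eventually (lt_mem_nhds (show (0 : ℝ) < (1 : ℂ).re by simp))).exists
  let κ : Ioi (0 : ℝ≥0) → ℝ := fun s => ω.ratio (mem_Ioi.1 s.2) u v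
  have hbdd : BddAbove (range κ) := by
    refine ⟨((ω.weight u).1 (cut (mem_Ioi.1 t₀.2) (1 - Lam 1))).re /
      ((ω.weight v).1 (cut (mem_Ioi.1 t₀.2) (1 - Lam 1))).re, ?_⟩
    rintro _ ⟨s, rfl⟩
    exact (le_div_iff₀ ht₀).2 (hd.ratio_mul_le' h _ _ one_sub_Lam_nonneg)
  refine ⟨⨆ s, κ s, ?_, fun t ht => le_ciSup hbdd ⟨t, ht⟩, fun t ht B hB => ?_⟩
  · exact (h.ratio_nonneg _).trans (le_ciSup hbdd ⟨1, mem_Ioi.2 one_pos⟩)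
  · rw [Real.iSup_mul_of_nonneg (Complex.nonneg_iff.1 (h.weight_cut_nonneg v ht hB)).1]
    have : Nonempty (Ioi (0 : ℝ≥0)) := ⟨⟨1, mem_Ioi.2 one_pos⟩⟩
    exact ciSup_le fun s => hd.ratio_mul_le' h _ ht hB

end BoundaryWeightMap

/-! ### Maps living on one line, and the subordinates they provide -/

namespace BoundaryWeightMap

open InnerProductSpace (rankOne)

variable {K : Type*} [NormedAddCommGroup K] [InnerProductSpace ℂ K] [CompleteSpace K]
  [FiniteDimensional ℂ K]

/-- The boundary weight map `ρ ↦ ρ(P) ν`. -/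
def rankOneMap (ν : boundaryWeights K) (P : K →L[ℂ] K) : BoundaryWeightMap K :=
  (evalPredual K P).smulRight ν

theorem rankOneMap_apply (ν : boundaryWeights K) (P : K →L[ℂ] K) (ρ : predual K) :
    rankOneMap ν P ρ = ρ.1 P • ν := rfl

theorem dualized_rankOneMap (ν : boundaryWeights K) (P : K →L[ℂ] K) :
    (rankOneMap ν P).dualized = ν.1.smulRight P := by
  refine LinearMap.ext fun B => eq_of_predual fun ρ => ?_
  rw [dualized_spec, rankOneMap_apply, LinearMap.smulRight_apply, map_smul, smul_eq_mul, mul_comm]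
  rfl

variable {ν : boundaryWeights K} {u : K}

theorem boundaryWeight_nonneg
    (hν : ∀ (t : ℝ≥0) (ht : 0 < t) (B : HalfL2 K →L[ℂ] HalfL2 K), 0 ≤ B → 0 ≤ ν.1 (cut ht B))
    (B : boundaryAlgebra K) (hB : 0 ≤ (B : HalfL2 K →L[ℂ] HalfL2 K)) : 0 ≤ ν.1 B :=
  ge_of_tendsto' (tendsto_cut ν.2 B) fun _ => hν _ _ _ hB

section RankOne

variable (hu : ‖u‖ = 1)
  (hν : ∀ (t : ℝ≥0) (ht : 0 < t) (B : HalfL2 K →L[ℂ] HalfL2 K), 0 ≤ B → 0 ≤ ν.1 (cut ht B))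

include hν in
-- Injectivity suffices in finite dimension. For `ρ` in the kernel, evaluation at `uu*` gives
-- `ρ(uu*)` times a number with real part at least `1`, so `ρ(uu*) = 0` and then `ρ = 0`.
theorem isUnit_oneAdd_rankOneMap {t : ℝ≥0} (ht : 0 < t) :
    IsUnit ((rankOneMap ν (rankOne ℂ u u)).oneAdd ht) := by
  suffices hinj : Function.Injective ((rankOneMap ν (rankOne ℂ u u)).oneAdd ht) from
    (Module.End.isUnit_iff _).2 ⟨hinj,
      LinearMap.surjective_of_injective (K := ℂ) (V := predual K)
        (f := (rankOneMap ν (rankOne ℂ u u)).oneAdd ht) hinj⟩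
  rw [injective_iff_map_eq_zero]
  intro ρ hρ
  have h1 : ∀ A, ρ.1 A + ρ.1 (rankOne ℂ u u) * ν.1 (cut ht (Lam A)) = 0 := by
    intro A
    have h2 := congrArg (fun σ : predual K => σ.1 A) hρ
    simp only [oneAdd_apply, cross_apply, dualized_rankOneMap, map_add] at h2
    rw [LinearMap.smulRight_apply, map_smul, smul_eq_mul, mul_comm] at h2
    exact h2
  have h2 := h1 (rankOne ℂ u u)
  have h3 := hν t ht _ (Lam_nonneg (rankOne_self_nonneg u))
  have h4 : ρ.1 (rankOne ℂ u u) = 0 := by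
    have h5 : ρ.1 (rankOne ℂ u u) * (1 + ν.1 (cut ht (Lam (rankOne ℂ u u)))) = 0 := by
      rw [mul_add, mul_one]; exact h2
    refine (mul_eq_zero.1 h5).resolve_right fun h6 => ?_
    have h7 := congrArg Complex.re h6
    have h8 := (Complex.nonneg_iff.1 h3).1
    rw [Complex.add_re, Complex.one_re, Complex.zero_re] at h7
    linarith
  refine Subtype.ext (ContinuousLinearMap.ext fun A => ?_)
  have h5 := h1 A
  rw [h4, zero_mul, add_zero] at h5
  exact h5

include hu hν in
theorem bdryRep_rankOneMap {t : ℝ≥0} (ht : 0 < t) (B : HalfL2 K →L[ℂ] HalfL2 K) :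
    (rankOneMap ν (rankOne ℂ u u)).bdryRep ht B =
      (rankOneMap ν (rankOne ℂ u u)).repFun ht u B • rankOne ℂ u u := by
  have h1 := bdryRep_eq_dualized (isUnit_oneAdd_rankOneMap (u := u) hν ht) B
  rw [repFun_apply, h1, dualized_rankOneMap, LinearMap.smulRight_apply]
  simp [inner_self_eq_norm_sq_to_K, hu]

include hu hν in
theorem weight_cut_rankOneMap {t : ℝ≥0} (ht : 0 < t) (B : HalfL2 K →L[ℂ] HalfL2 K) :
    ν.1 (cut ht B) = (1 + ν.1 (cut ht (Lam (rankOne ℂ u u)))) *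
      (rankOneMap ν (rankOne ℂ u u)).repFun ht u B := by
  have h1 := dualized_cut (isUnit_oneAdd_rankOneMap (u := u) hν ht) B
  rw [bdryRep_rankOneMap hu hν, map_smul, cross_apply, dualized_rankOneMap,
    LinearMap.smulRight_apply, LinearMap.smulRight_apply, smul_smul, ← add_smul] at h1
  have h2 : rankOne ℂ u u ≠ 0 := by
    have : u ≠ 0 := fun h => by simp [h] at hu
    exact InnerProductSpace.rankOne_ne_zero this this
  have h3 := smul_left_injective ℂ h2 h1
  rw [h3]
  ring

include hu hν in
theorem repFun_rankOneMap_nonneg {t : ℝ≥0} (ht : 0 < t) {B : HalfL2 K →L[ℂ] HalfL2 K}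
    (hB : 0 ≤ B) : 0 ≤ (rankOneMap ν (rankOne ℂ u u)).repFun ht u B := by
  have h1 := weight_cut_rankOneMap hu hν ht B
  have h2 := hν t ht B hB
  have h3 : 0 < 1 + ν.1 (cut ht (Lam (rankOne ℂ u u))) :=
    add_pos_of_pos_of_nonneg one_pos (hν t ht _ (Lam_nonneg (rankOne_self_nonneg u)))
  rw [h1] at h2
  exact le_of_mul_le_mul_left (by rwa [mul_zero]) h3

include hu hν in
-- Here `π_t^#` is a positive functional times the projection `uu*`, so complete positivity is
-- automatic and contractivity is the bound on the value at `I`.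
theorem isQWeightMap_rankOneMap
    (hone : ν.1 ⟨1 - Lam 1, one_sub_Lam_mem K⟩ ≤ 1)
    (hrep : ∀ (t : ℝ≥0) (ht : 0 < t),
      ((rankOneMap ν (rankOne ℂ u u)).repFun ht u 1).re ≤ 1) :
    (rankOneMap ν (rankOne ℂ u u)).IsQWeightMap where
  cp := by
    rw [dualized_rankOneMap]
    exact isCPOn_smulRight (boundaryWeight_nonneg hν) (rankOne_self_nonneg u)
  bound ρ hρ := by
    have h1 := hρ _ (rankOne_self_nonneg u)
    have h2 := hρ _ (sub_nonneg.2 (rankOne_self_le_one hu))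
    rw [map_sub, sub_nonneg] at h2
    exact (mul_le_of_le_one_right h1 hone).trans h2
  invertible t ht := isUnit_oneAdd_rankOneMap hν ht
  piHat_cp t ht := by
    have : (rankOneMap ν (rankOne ℂ u u)).bdryRep ht =
        ((rankOneMap ν (rankOne ℂ u u)).repFun ht u).smulRight (rankOne ℂ u u) :=
      LinearMap.ext fun B => bdryRep_rankOneMap hu hν ht B
    rw [this]
    exact isCP_smulRight (fun A hA => repFun_rankOneMap_nonneg hu hν ht hA) (rankOne_self_nonneg u)
  piHat_contraction t ht ρ := by
    refine ContinuousLinearMap.opNorm_le_bound _ (norm_nonneg ρ.1) fun B => ?_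
    have h1 : ((rankOneMap ν (rankOne ℂ u u)).piHat ht ρ).1 B =
        (rankOneMap ν (rankOne ℂ u u)).repFun ht u B * ρ.1 (rankOne ℂ u u) := by
      rw [← bdryRep_spec, bdryRep_rankOneMap hu hν, map_smul, smul_eq_mul]
    refine (congrArg norm h1).trans_le ?_
    rw [norm_mul]
    have h2 : ‖ρ.1 (rankOne ℂ u u)‖ ≤ ‖ρ‖ := by
      refine (ρ.1.le_opNorm _).trans ?_
      rw [InnerProductSpace.norm_rankOne, hu, mul_one, mul_one]
      rfl
    have h3 := norm_apply_le_of_positive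
      (fun A hA => repFun_rankOneMap_nonneg (u := u) hu hν ht hA) B
    have h4 : ‖(rankOneMap ν (rankOne ℂ u u)).repFun ht u B‖ ≤ ‖B‖ :=
      h3.trans (mul_le_of_le_one_left (norm_nonneg _) (hrep t ht))
    rw [mul_comm]
    gcongr

end RankOne

variable {ω : BoundaryWeightMap K} {v : K}

/-- A diagonal unital `q`-weight map has a `q`-subordinate of range rank at most one that lives on
the first coordinate. -/
theorem IsDiagonal.exists_subordinate (hd : ω.IsDiagonal u v) (h : ω.IsQWeightMap)
    (hun : ω.IsUnital) :
    ∃ k : ℂ, (rankOneMap (ω.weight u - k • ω.weight v) (rankOne ℂ u u)).IsQWeightMap ∧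
      QSubordinate (rankOneMap (ω.weight u - k • ω.weight v) (rankOne ℂ u u)) ω ∧
      ∀ (t : ℝ≥0) (ht : 0 < t) (B : HalfL2 K →L[ℂ] HalfL2 K), 0 ≤ B →
        0 ≤ (ω.weight u - k • ω.weight v).1 (cut ht B) := by
  obtain ⟨k, hk0, hk1, hk2⟩ := hd.exists_ratio_bound h hun
  set ν := ω.weight u - (k : ℂ) • ω.weight v with hνdef
  have hνa : ∀ B, ν.1 B = (ω.weight u).1 B - k * (ω.weight v).1 B := fun B => rfl
  have hν : ∀ (t : ℝ≥0) (ht : 0 < t) (B : HalfL2 K →L[ℂ] HalfL2 K), 0 ≤ B →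
      0 ≤ ν.1 (cut ht B) := by
    intro t ht B hB
    have h1 := Complex.nonneg_iff.1 (h.weight_cut_nonneg u ht hB)
    have h2 := Complex.nonneg_iff.1 (h.weight_cut_nonneg v ht hB)
    rw [hνa, Complex.nonneg_iff, Complex.sub_re, Complex.sub_im, Complex.re_ofReal_mul,
      Complex.im_ofReal_mul, ← h1.2, ← h2.2]
    exact ⟨sub_nonneg.2 (hk2 t ht B hB), by simp⟩
  set η := rankOneMap ν (rankOne ℂ u u) with hη
  -- Write `r_u`, `r_v`, `r_η` for the functionals of `π_t^#` and of its analogue for `η`.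
  -- Substituting the linear system into `ν = ω_u - kω_v` gives `α r_η = α r_u - β r_v`, so `c =
  -- β/α`. Here `β ≥ 0` because `k` bounds the ratio at `t`, and `α > 0` because `ν` is positive.
  have hkey : ∀ (t : ℝ≥0) (ht : 0 < t), ∃ c : ℝ, 0 ≤ c ∧
      ∀ B, ω.repFun ht u B - η.repFun ht u B = c * ω.repFun ht v B := by
    intro t ht
    set α : ℝ := 1 + ω.coupling ht u u - k * ω.coupling ht v u with hα
    set β : ℝ := k * (1 + ω.coupling ht v v) - ω.coupling ht u v with hβ
    have hβ0 : 0 ≤ β := by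
      have h1 := hk1 t ht
      rw [ratio, div_le_iff₀ (by linarith [h.coupling_nonneg ht v v])] at h1
      linarith
    have hα' : 1 + ν.1 (cut ht (Lam (rankOne ℂ u u))) = α := by
      rw [hνa, h.coe_coupling, h.coe_coupling, hα]
      push_cast
      ring
    have hα0 : 0 < α := by
      have h1 : (0 : ℂ) < 1 + ν.1 (cut ht (Lam (rankOne ℂ u u))) :=
        add_pos_of_pos_of_nonneg one_pos (hν t ht _ (Lam_nonneg (rankOne_self_nonneg u)))
      rw [hα'] at h1
      exact Complex.zero_lt_real.1 h1
    refine ⟨β / α, by positivity, fun B => ?_⟩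
    have h1 := weight_cut_rankOneMap (u := u) hd.norm_left hν ht B
    rw [← hη, hα', hνa, hd.weight_cut h ht, hd.symm.weight_cut h ht] at h1
    have h2 : (α : ℂ) ≠ 0 := Complex.ofReal_ne_zero.2 hα0.ne'
    refine mul_left_cancel₀ h2 ?_
    rw [mul_sub, ← h1]
    push_cast
    rw [← mul_assoc, mul_div_cancel₀ _ h2, hα, hβ]
    push_cast
    ring
  refine ⟨k, isQWeightMap_rankOneMap hd.norm_left hν ?_ fun t ht => ?_, fun t ht => ?_, hν⟩
  · rw [hνa, hun.weight_one_sub_Lam hd.norm_left, hun.weight_one_sub_Lam hd.norm_right, mul_one]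
    have : (0 : ℂ) ≤ k := Complex.zero_le_real.2 hk0
    exact sub_le_self _ this
  · obtain ⟨c, hc, hcB⟩ := hkey t ht
    have h1 := congrArg Complex.re (hcB 1)
    rw [Complex.sub_re, Complex.re_ofReal_mul] at h1
    have h2 := mul_nonneg hc (Complex.nonneg_iff.1 (h.repFun_nonneg ht v zero_le_one)).1
    have h3 := h.repFun_one_le ht hd.norm_left
    linarith
  · obtain ⟨c, hc, hcB⟩ := hkey t ht
    -- The difference is `r_v` times `c uu* + vv*`: a positive functional times a positive operator.
    have h1 : ω.bdryRep ht - η.bdryRep ht =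
        (ω.repFun ht v).smulRight ((c : ℂ) • rankOne ℂ u u + rankOne ℂ v v) := by
      refine LinearMap.ext fun B => ?_
      rw [LinearMap.sub_apply, hd.bdryRep_eq h, hη, bdryRep_rankOneMap hd.norm_left hν, ← hη,
        LinearMap.smulRight_apply, smul_add, smul_smul, mul_comm, ← hcB, sub_smul]
      abel
    rw [h1]
    refine isCP_smulRight (fun A hA => h.repFun_nonneg ht v hA) ?_
    exact add_nonneg (smul_nonneg (Complex.zero_le_real.2 hc) (rankOne_self_nonneg u))
      (rankOne_self_nonneg v)

/-- Rank one maps on orthogonal coordinates are comparable only if the smaller one vanishes. -/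
theorem eq_zero_of_qSubordinate {μ : boundaryWeights K} (hu : ‖u‖ = 1) (hv : ‖v‖ = 1)
    (huv : ⟪u, v⟫_ℂ = 0)
    (hν : ∀ (t : ℝ≥0) (ht : 0 < t) (B : HalfL2 K →L[ℂ] HalfL2 K), 0 ≤ B → 0 ≤ ν.1 (cut ht B))
    (hμ : ∀ (t : ℝ≥0) (ht : 0 < t) (B : HalfL2 K →L[ℂ] HalfL2 K), 0 ≤ B → 0 ≤ μ.1 (cut ht B))
    (hsub : QSubordinate (rankOneMap ν (rankOne ℂ u u)) (rankOneMap μ (rankOne ℂ v v))) :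
    ν = 0 := by
  have h1 : ∀ (t : ℝ≥0) (ht : 0 < t), (rankOneMap ν (rankOne ℂ u u)).repFun ht u 1 = 0 := by
    intro t ht
    refine le_antisymm ?_ (repFun_rankOneMap_nonneg hu hν ht zero_le_one)
    -- At the vector `u`, orthogonal to `v`, the larger map contributes nothing. The difference at
    -- `I` is then minus the functional being estimated.
    have h2 := (nonneg_iff_inner _).1 ((hsub t ht).map_nonneg zero_le_one) u
    rw [LinearMap.sub_apply, bdryRep_rankOneMap hv hμ, bdryRep_rankOneMap hu hν] at h2
    simpa [inner_sub_right, inner_smul_right, huv, inner_self_eq_norm_sq_to_K, hu] using h2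
  have h2 : ∀ (t : ℝ≥0) (ht : 0 < t) (B : HalfL2 K →L[ℂ] HalfL2 K), ν.1 (cut ht B) = 0 := by
    intro t ht B
    have h3 := norm_apply_le_of_positive
      (fun A hA => repFun_rankOneMap_nonneg (u := u) hu hν ht hA) B
    rw [h1, Complex.zero_re, zero_mul] at h3
    rw [weight_cut_rankOneMap hu hν ht B, norm_le_zero_iff.1 h3, mul_zero]
  refine Subtype.ext (LinearMap.ext fun B => ?_)
  have h3 := tendsto_cut ν.2 B
  simp only [h2] at h3
  exact tendsto_nhds_unique h3 tendsto_const_nhds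

/-! ### The possible range ranks -/

theorem IsDiagonal.rangeRank_le_one (hd : ω.IsDiagonal u v) {k : ℂ}
    (hk : ω.weight u - k • ω.weight v = 0) : ω.rangeRank ≤ 1 := by
  have h1 : LinearMap.range ω.dualized ≤
      Submodule.span ℂ {k • rankOne ℂ u u + rankOne ℂ v v} := by
    rintro _ ⟨B, rfl⟩
    have h2 : (ω.weight u).1 B = k * (ω.weight v).1 B :=
      congrArg (fun μ : boundaryWeights K => μ.1 B) (sub_eq_zero.1 hk)
    rw [hd.dualized_eq, h2]
    exact Submodule.mem_span_singleton.2 ⟨(ω.weight v).1 B, by module⟩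
  refine (Submodule.finrank_mono h1).trans ((finrank_span_le_card _).trans ?_)
  simp

/-- Purity makes the subordinates on the lines of `u` and `v` comparable. The smaller one vanishes,
which means that the two weights are proportional. -/
theorem IsDiagonal.rangeRank_le_one_of_isQPure (hd : ω.IsDiagonal u v) (h : ω.IsQWeightMap)
    (hun : ω.IsUnital) (hpure : ω.IsQPure) : ω.rangeRank ≤ 1 := by
  obtain ⟨k, hq, hs, hν⟩ := hd.exists_subordinate h hun
  obtain ⟨k', hq', hs', hν'⟩ := hd.symm.exists_subordinate h hun
  rcases hpure _ _ hq hq' hs hs' with h1 | h1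
  · exact hd.rangeRank_le_one
      (eq_zero_of_qSubordinate hd.norm_left hd.norm_right hd.inner_eq_zero hν hν' h1)
  · exact hd.symm.rangeRank_le_one
      (eq_zero_of_qSubordinate hd.norm_right hd.norm_left hd.symm.inner_eq_zero hν' hν h1)

theorem rangeRank_ne_zero (hω : ω ≠ 0) : ω.rangeRank ≠ 0 := by
  intro h
  have h1 : LinearMap.range ω.dualized = ⊥ := Submodule.finrank_eq_zero.1 h
  refine hω (LinearMap.ext fun ρ => Subtype.ext (LinearMap.ext fun B => ?_))
  rw [← dualized_spec, LinearMap.range_eq_bot.1 h1]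
  simp

/-- By rank–nullity in dimension 4, rank 3 would give the projection `L` a one-dimensional kernel.
-/
theorem rangeRank_ne_three (hK : Module.finrank ℂ K = 2) (hω : ω.IsQWeightMap)
    (hspine : ω.HasTrivialNormalSpine) : ω.rangeRank ≠ 3 := by
  intro h3
  obtain ⟨L, hstar, hcp, hmem, hfix⟩ := exists_projection hω hspine
  refine finrank_ker_ne_one hK hstar hcp (fun A => hfix _ (hmem A)) ?_
  have hr : LinearMap.range L = LinearMap.range ω.dualized :=
    le_antisymm (by rintro _ ⟨A, rfl⟩; exact hmem A) fun A hA => ⟨A, hfix A hA⟩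
  have h1 := LinearMap.finrank_range_add_finrank_ker L
  have h2 : Module.finrank ℂ (K →L[ℂ] K) = 4 := by
    rw [← (LinearMap.toContinuousLinearMap (𝕜 := ℂ) (E := K) (F' := K)).finrank_eq,
      Module.finrank_linearMap, hK]
  rw [hr, h2] at h1
  rw [rangeRank] at h3
  omega

theorem rangeRank_le_four (hK : Module.finrank ℂ K = 2) : ω.rangeRank ≤ 4 := by
  refine (Submodule.finrank_le _).trans_eq ?_
  rw [← (LinearMap.toContinuousLinearMap (𝕜 := ℂ) (E := K) (F' := K)).finrank_eq,
    Module.finrank_linearMap, hK]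

/-- The range contains `I = ω̆(I - Λ(I))` by unitality, and it is selfadjoint because it is fixed by
`L`, which preserves adjoints and maps into it. -/
theorem exists_isDiagonal (hK : Module.finrank ℂ K = 2) (hω : ω.IsQWeightMap)
    (hspine : ω.HasTrivialNormalSpine) (hun : ω.IsUnital) (h2 : ω.rangeRank = 2) :
    ∃ u v, ω.IsDiagonal u v := by
  obtain ⟨L, hstar, hcp, hmem, hfix⟩ := exists_projection hω hspine
  have hone : (1 : K →L[ℂ] K) ∈ LinearMap.range ω.dualized := by
    refine ⟨⟨1 - Lam 1, one_sub_Lam_mem K⟩, eq_of_predual fun ρ => ?_⟩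
    rw [dualized_spec]
    exact hun ρ
  obtain ⟨b, hb⟩ := exists_diagonal_basis hK hone (fun A hA => by
    rw [← hfix A hA, ← hstar]; exact hmem _) h2
  refine ⟨b 0, b 1, b.norm_eq_one 0, b.norm_eq_one 1, b.orthonormal.2 (by simp), fun B => ?_⟩
  rw [weight_apply, weight_apply]
  exact hb _ ⟨B, rfl⟩

end BoundaryWeightMap

end QWeight

end

theorem mainTheorem5 (ω : QWeight.BoundaryWeightMap (EuclideanSpace ℂ (Fin 2)))
    (hω : ω.IsQWeightMap) (hspine : ω.HasTrivialNormalSpine) :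
    (ω ≠ 0 → ω.rangeRank = 1 ∨ ω.rangeRank = 2 ∨ ω.rangeRank = 4) ∧
    (ω.IsUnital → ω.IsQPure → ω.rangeRank = 1 ∨ ω.rangeRank = 4) := by
  have hK : Module.finrank ℂ (EuclideanSpace ℂ (Fin 2)) = 2 := finrank_euclideanSpace_fin
  have h3 := QWeight.BoundaryWeightMap.rangeRank_ne_three hK hω hspine
  have h4 := QWeight.BoundaryWeightMap.rangeRank_le_four (ω := ω) hK
  have h0 := QWeight.BoundaryWeightMap.rangeRank_ne_zero (ω := ω)
  refine ⟨fun hne => ?_, fun hun hpure => ?_⟩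
  · have := h0 hne
    omega
  -- The zero map is not unital: a unit vector would give `0 = 1`.
  · have hne : ω ≠ 0 := by
      rintro rfl
      obtain ⟨u, hu⟩ := exists_norm_eq (EuclideanSpace ℂ (Fin 2)) zero_le_one
      have := hun.weight_one_sub_Lam hu
      simp [QWeight.BoundaryWeightMap.weight] at this
    have h2 : ω.rangeRank ≠ 2 := fun h2 => by
      obtain ⟨u, v, hd⟩ := QWeight.BoundaryWeightMap.exists_isDiagonal hK hω hspine hun h2
      have := hd.rangeRank_le_one_of_isQPure hω hun hpure
      omega
    have := h0 hne
    omega
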